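/- For $n\ge 2$, a boolean cellular automaton $B$ with $n$ gates assigns to each gate $i\in\{1,\dots,n\}$ two distinct inputs $j_i<k_i$ in $\{1,\dots,n\}$ (a gate may be its own input) and a boolean function $f_i:\{0,1\}^2\to\{0,1\}$. It defines the map $B:\{0,1\}^n\to\{0,1\}^n$, $B(x)_i=f_i(x_{j_i},x_{k_i})$. For $x\in\{0,1\}^n$ let $t_1$ be the first time such that $B^{t_0}(x)=B^{t_1}(x)$ for some $t_0<t_1$; the state cycle of $x$ is the set $\{B^t(x):t\ge t_0\}$, and its size is its number of elements. Call $f:\{0,1\}^2\to\{0,1\}$ canalyzing if fixing one of its two arguments to some value $u$ makes $f$ take a constant value $v$ regardless of the other argument. Let $\mathcal A$ be the set of the two constant functions, $\mathcal B_1$ the set of the four canalyzing functions that depend on exactly one argument, $\mathcal B_2$ the set of the eight canalyzing functions that depend on both arguments, and $\mathcal C$ the set of the two non-canalyzing functions. Let $(a_f)_f$ be a probability distribution on the 16 functions $f:\{0,1\}^2\to\{0,1\}$ with $a_f=a_{\neg f}$ for all $f\in\mathcal A\cup\mathcal B_2$ and $a_{f(x,y)}=a_{f(y,x)}$ for all $f\in\mathcal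 B_1$. Put $a=\sum_{f\in\mathcal A}a_f$ and $c=\sum_{f\in\mathcal C}a_f$. For $n\ge2$ let $\tilde B_n$ be the random boolean cellular automaton with $n$ gates in which, independently for all gates, the input pair is uniform among the $\binom n2$ two-element sets of gates and, independently of the input pairs, the boolean function is $f$ with probability $a_f$. **Theorem 4.10 (bounded state cycles).** If $a>c$, then for every $\varepsilon>0$ there is a constant $s$ such that for every $n\ge2$ $$\Pr\bigl(\tilde B_n\text{ has a state cycle of size larger than }s\bigr)<\varepsilon .$$ -/

import Mathlib

noncomputable section

namespace RandomBCA

/-- Boolean functions of two arguments. -/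
abbrev BoolFn : Type := Bool → Bool → Bool

/-- `f` depends on its first argument. -/
abbrev DependsFst (f : BoolFn) : Prop := ∃ v, f false v ≠ f true v

/-- `f` depends on its second argument. -/
abbrev DependsSnd (f : BoolFn) : Prop := ∃ v, f v false ≠ f v true

/-- `f` is canalyzing: one of its arguments (the first or the second) has a forcing value `u`
with some forced value `v`. -/
abbrev Canalyzing (f : BoolFn) : Prop :=
  ∃ u v, (∀ y, f u y = v) ∨ (∀ x, f x u = v)

/-- The class `A`: the constant functions. -/
abbrev IsClassA (f : BoolFn) : Prop := ∃ v, ∀ x y, f x y = v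

/-- The class `B₁`: canalyzing functions that depend on exactly one argument. -/
abbrev IsClassB₁ (f : BoolFn) : Prop :=
  Canalyzing f ∧ ((DependsFst f ∧ ¬ DependsSnd f) ∨ (¬ DependsFst f ∧ DependsSnd f))

/-- The class `B₂`: canalyzing functions that depend on both arguments. -/
abbrev IsClassB₂ (f : BoolFn) : Prop :=
  Canalyzing f ∧ DependsFst f ∧ DependsSnd f

/-- The class `C`: the non-canalyzing functions. -/
abbrev IsClassC (f : BoolFn) : Prop := ¬ Canalyzing f

/-- The negation `¬ f`. -/
def negFn (f : BoolFn) : BoolFn := fun x y => !(f x y)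

/-- The function `f(y, x)` with the arguments exchanged. -/
def swapFn (f : BoolFn) : BoolFn := fun x y => f y x

/-- `w` is a probability distribution on the two-argument boolean functions. -/
structure IsDistribution (w : BoolFn → ℝ) : Prop where
  nonneg : ∀ f, 0 ≤ w f
  sum_eq_one : ∑ f, w f = 1

/-- The symmetry conditions on the distribution. -/
structure IsSymmetric (w : BoolFn → ℝ) : Prop where
  neg : ∀ f, IsClassA f ∨ IsClassB₂ f → w f = w (negFn f)
  swap : ∀ f, IsClassB₁ f → w f = w (swapFn f)

/-- `a`: the probability that a gate is assigned a constant function. -/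
def probA (w : BoolFn → ℝ) : ℝ := ∑ f with IsClassA f, w f

/-- `c`: the probability that a gate is assigned a non-canalyzing function. -/
def probC (w : BoolFn → ℝ) : ℝ := ∑ f with IsClassC f, w f

/-- The possible pairs of inputs of a gate, i.e. the two-element sets `{j, k}` of gates, each
written in increasing order `j < k`. A gate may be one of its own inputs. -/
abbrev InputPair (n : ℕ) : Type := {p : Fin n × Fin n // p.1 < p.2}

/-- A boolean cellular automaton with `n` gates: a digraph of indegree two, given by the two
in-neighbours of each gate, and a boolean function for each gate. -/
structure Automaton (n : ℕ) where
  inputs : Fin n → InputPair n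
  fn : Fin n → BoolFn

namespace Automaton

variable {n : ℕ}

/-- The map `{0,1}ⁿ → {0,1}ⁿ` defined by the automaton. -/
def step (B : Automaton n) (x : Fin n → Bool) : Fin n → Bool :=
  fun i => B.fn i (x (B.inputs i).1.1) (x (B.inputs i).1.2)

/-- The state `Bᵗ(x)` at time `t` from the initial state `x`. -/
def stateAt (B : Automaton n) (x : Fin n → Bool) (t : ℕ) : Fin n → Bool :=
  B.step^[t] x

/-- `t₁`: the first time at which the state equals an earlier state. -/
def firstRepeat (B : Automaton n) (x : Fin n → Bool) : ℕ :=
  sInf {t₁ | ∃ t₀ < t₁, B.stateAt x t₀ = B.stateAt x t₁}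

/-- `t₀`: the earlier time at which the state of time `t₁ = firstRepeat` was visited. -/
def cycleStart (B : Automaton n) (x : Fin n → Bool) : ℕ :=
  sInf {t₀ | t₀ < B.firstRepeat x ∧ B.stateAt x t₀ = B.stateAt x (B.firstRepeat x)}

/-- The state cycle of `x`: the set `{Bᵗ(x) : t ≥ t₀}`. -/
def stateCycle (B : Automaton n) (x : Fin n → Bool) : Set (Fin n → Bool) :=
  {y | ∃ t, B.cycleStart x ≤ t ∧ B.stateAt x t = y}

/-- The automaton has a state cycle with more than `s` states. -/
def HasStateCycleLargerThan (B : Automaton n) (s : ℕ) : Prop :=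
  ∃ x : Fin n → Bool, s < (B.stateCycle x).ncard

end Automaton

open Classical in
/-- `pr(P, n)`: the probability that the random automaton with `n` gates has property `P`, where
independently for each gate the inputs are uniform among the `n.choose 2` possible pairs, and
independently of all else the gate gets the function `f` with probability `w f`. -/
def pr (w : BoolFn → ℝ) (n : ℕ) (P : Automaton n → Prop) : ℝ :=
  ∑ D : Fin n → InputPair n, ∑ f : Fin n → BoolFn,
    if P ⟨D, f⟩ then ∏ i, (1 / (n.choose 2 : ℝ)) * w (f i) else 0

end RandomBCA

end

namespace RandomBCA

noncomputable section

section FiniteExpectation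

/-! ### Expectations over finite product spaces -/

/-! Give each gate a label: the value forced on it within `t` rounds by constant gates upstream, or
`none`. From time `t` on a forced gate keeps its forced value, so an input matters only if the
function depends on it for some value of the other input that its label admits. Keep only these
effective edges. A trajectory is eventually driven by the effective digraph, and peeling off its
terminal strong components shows that a state cycle has at most `2 ^ m` states, where `m` counts the
gates on effective cycles (`ncard_stateCycle_le_cyclicGates`). It remains to show that `m` is tight
as `n` grows.

For many gates the in-tree of a gate is close to a branching tree. There the symmetry of the weights
makes the two forced values equally likely, and the unforced probability `u` obeys `u' = (1 - a + c)
* u - c * u ^ 2`, so it tends to `0` (`unforced_succ_le`). When the other input has a uniform forced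
value, each input is effective with probability `(1 - a + c) / 2`. The mean number of effective
inputs is therefore close to `1 - a + c < 1` (`sum_law_effProb_le`), so the effective digraph is
subcritical. Asymptotic independence of two labels (`exists_lawProd_sub_le`) and a second moment
bound carry this to the finite automaton (`expect_meanEff_large_le`).

The obstacle to counting walks is that labels and edges come from the same gates. For a fixed walk
with target set `S`, labels computed without reading the gates in `S` are independent of those
gates, which can then be averaged out. Ignoring `S` changes few labels when outdegrees are small, so
the expected number of effective walks with `k` edges and a prescribed end is at most `lam ^ k` for
some `lam < 1` (`expect_isEffWalk_le`, `sum_expect_isEffWalk_le`). With a length `K` that is a small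
power of `n`, walks of length `K` are unlikely to occur, the expected number of shorter cycles is
bounded by a geometric series, and Markov's inequality finishes. -/

open Classical in
/-- The real-valued indicator of a proposition. -/
def ind (P : Prop) : ℝ := if P then 1 else 0

theorem ind_of_true {P : Prop} (h : P) : ind P = 1 := by simp [ind, h]

theorem ind_of_false {P : Prop} (h : ¬ P) : ind P = 0 := by simp [ind, h]

theorem ind_nonneg (P : Prop) : 0 ≤ ind P := by
  by_cases h : P <;> simp [ind, h]

theorem ind_le_one (P : Prop) : ind P ≤ 1 := by
  by_cases h : P <;> simp [ind, h]

theorem ind_mono {P Q : Prop} (h : P → Q) : ind P ≤ ind Q := by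
  by_cases hP : P
  · rw [ind_of_true hP, ind_of_true (h hP)]
  · rw [ind_of_false hP]; exact ind_nonneg Q

theorem ind_congr {P Q : Prop} (h : P ↔ Q) : ind P = ind Q := by
  rw [propext h]

theorem ind_and (P Q : Prop) : ind (P ∧ Q) = ind P * ind Q := by
  by_cases hP : P <;> by_cases hQ : Q <;> simp [ind, hP, hQ]

theorem ind_or_le (P Q : Prop) : ind (P ∨ Q) ≤ ind P + ind Q := by
  by_cases hP : P <;> by_cases hQ : Q <;> simp [ind, hP, hQ]

theorem ind_forall {κ : Type*} [Fintype κ] (P : κ → Prop) :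
    ind (∀ l, P l) = ∏ l, ind (P l) := by
  by_cases h : ∀ l, P l
  · rw [ind_of_true h, Finset.prod_eq_one fun l _ => ind_of_true (h l)]
  · rw [ind_of_false h]
    push Not at h
    obtain ⟨l, hl⟩ := h
    exact (Finset.prod_eq_zero (Finset.mem_univ l) (ind_of_false hl)).symm

theorem ind_exists_le {κ : Type*} [Fintype κ] (P : κ → Prop) :
    ind (∃ l, P l) ≤ ∑ l, ind (P l) := by
  by_cases h : ∃ l, P l
  · obtain ⟨l, hl⟩ := h
    rw [ind_of_true ⟨l, hl⟩, ← ind_of_true hl]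
    exact Finset.single_le_sum (f := fun l => ind (P l)) (fun l _ => ind_nonneg _)
      (Finset.mem_univ l)
  · rw [ind_of_false h]
    exact Finset.sum_nonneg fun l _ => ind_nonneg _

/-- Exchanging `ω i` with an independent copy `g` preserves the product weight; this is what makes
resampling legitimate. -/
theorem prod_update_mul {ι G : Type*} [Fintype ι] [DecidableEq ι] {ρ : G → ℝ} (ω : ι → G)
    (i : ι) (g : G) :
    (∏ k, ρ (Function.update ω i g k)) * ρ (ω i) = (∏ k, ρ (ω k)) * ρ g := by
  rw [Fintype.prod_eq_mul_prod_compl i, Fintype.prod_eq_mul_prod_compl i (fun k => ρ (ω k))]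
  have : ∏ k ∈ ({i} : Finset ι)ᶜ, ρ (Function.update ω i g k) = ∏ k ∈ ({i} : Finset ι)ᶜ, ρ (ω k) :=
    Finset.prod_congr rfl fun k hk => by
      rw [Function.update_of_ne (by simpa using hk)]
  rw [this, Function.update_self]
  ring

variable {ι G : Type*} [Fintype ι] [DecidableEq ι] [Fintype G]

/-- The expectation of `F` when all coordinates are independent with distribution `ρ`. -/
def expect (ρ : G → ℝ) (F : (ι → G) → ℝ) : ℝ :=
  ∑ ω, (∏ i, ρ (ω i)) * F ω

/-- `ρ` is a probability weight. -/
structure IsWeight (ρ : G → ℝ) : Prop where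
  nonneg : ∀ g, 0 ≤ ρ g
  sum_eq_one : ∑ g, ρ g = 1

variable {ρ : G → ℝ}

theorem expect_mono (hρ : IsWeight ρ) {F F' : (ι → G) → ℝ} (h : ∀ ω, F ω ≤ F' ω) :
    expect ρ F ≤ expect ρ F' :=
  Finset.sum_le_sum fun ω _ =>
    mul_le_mul_of_nonneg_left (h ω) (Finset.prod_nonneg fun _ _ => hρ.nonneg _)

theorem expect_nonneg (hρ : IsWeight ρ) {F : (ι → G) → ℝ} (h : ∀ ω, 0 ≤ F ω) :
    0 ≤ expect ρ F :=
  Finset.sum_nonneg fun ω _ =>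
    mul_nonneg (Finset.prod_nonneg fun _ _ => hρ.nonneg _) (h ω)

theorem expect_prod (f : ι → G → ℝ) :
    expect ρ (fun ω => ∏ i, f i (ω i)) = ∏ i, ∑ g, ρ g * f i g := by
  rw [Finset.prod_univ_sum, expect, Fintype.piFinset_univ]
  exact Finset.sum_congr rfl fun ω _ => Finset.prod_mul_distrib.symm

theorem expect_const (hρ : IsWeight ρ) (c : ℝ) :
    expect ρ (fun _ : ι → G => c) = c := by
  have h := expect_prod (ρ := ρ) (fun (_ : ι) (_ : G) => (1 : ℝ))
  simp only [mul_one, hρ.sum_eq_one, Finset.prod_const_one] at h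
  simp only [expect, mul_one] at h
  rw [expect, ← Finset.sum_mul, h, one_mul]

theorem expect_add (F F' : (ι → G) → ℝ) :
    expect ρ (fun ω => F ω + F' ω) = expect ρ F + expect ρ F' := by
  simp only [expect, mul_add, Finset.sum_add_distrib]

theorem expect_const_mul (c : ℝ) (F : (ι → G) → ℝ) :
    expect ρ (fun ω => c * F ω) = c * expect ρ F := by
  simp only [expect, Finset.mul_sum]
  exact Finset.sum_congr rfl fun ω _ => by ring

theorem expect_sum {κ : Type*} (s : Finset κ) (F : κ → (ι → G) → ℝ) :
    expect ρ (fun ω => ∑ k ∈ s, F k ω) = ∑ k ∈ s, expect ρ (F k) := by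
  simp only [expect, Finset.mul_sum]
  exact Finset.sum_comm

/-- Resampling one coordinate does not change the expectation. -/
theorem expect_resample (hρ : IsWeight ρ) (i : ι) (F : (ι → G) → ℝ) :
    expect ρ F = expect ρ (fun ω => ∑ g, ρ g * F (Function.update ω i g)) := by
  have h1 : expect ρ F = ∑ x : (ι → G) × G, (∏ k, ρ (x.1 k)) * ρ x.2 * F x.1 := by
    rw [Fintype.sum_prod_type, expect]
    refine Finset.sum_congr rfl fun ω _ => ?_
    dsimp only
    rw [← Finset.sum_mul, ← Finset.mul_sum, hρ.sum_eq_one, mul_one]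
  have h2 : expect ρ (fun ω => ∑ g, ρ g * F (Function.update ω i g)) =
      ∑ x : (ι → G) × G, (∏ k, ρ (x.1 k)) * ρ x.2 * F (Function.update x.1 i x.2) := by
    rw [Fintype.sum_prod_type, expect]
    refine Finset.sum_congr rfl fun ω _ => ?_
    rw [Finset.mul_sum]
    exact Finset.sum_congr rfl fun g _ => by ring
  rw [h1, h2]
  refine Finset.sum_nbij' (fun x => (Function.update x.1 i x.2, x.1 i))
    (fun x => (Function.update x.1 i x.2, x.1 i)) ?_ ?_ ?_ ?_ ?_
  · simp
  · simp
  · rintro ⟨ω, g⟩ _; simp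
  · rintro ⟨ω, g⟩ _; simp
  · rintro ⟨ω, g⟩ _
    simp [prod_update_mul]

/-- Independence: if `Φ` and all `ψ l g` do not depend on the distinct coordinates `tgt l`, then
these coordinates can be averaged out one by one. -/
theorem expect_mul_prod {κ : Type*} [Fintype κ] (hρ : IsWeight ρ) (tgt : κ → ι)
    (htgt : Function.Injective tgt) (ψ : κ → G → (ι → G) → ℝ)
    (hψ : ∀ l l' g g' ω, ψ l g (Function.update ω (tgt l') g') = ψ l g ω) (T : Finset κ)
    (Φ : (ι → G) → ℝ) (hΦ : ∀ l g ω, Φ (Function.update ω (tgt l) g) = Φ ω) :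
    expect ρ (fun ω => Φ ω * ∏ l ∈ T, ψ l (ω (tgt l)) ω) =
      expect ρ (fun ω => Φ ω * ∏ l ∈ T, ∑ g, ρ g * ψ l g ω) := by
  classical
  induction T using Finset.induction_on generalizing Φ with
  | empty => rfl
  | insert a T ha ih =>
    have h1 : expect ρ (fun ω => Φ ω * ∏ l ∈ insert a T, ψ l (ω (tgt l)) ω) =
        expect ρ (fun ω => (Φ ω * ∑ g, ρ g * ψ a g ω) * ∏ l ∈ T, ψ l (ω (tgt l)) ω) := by
      rw [expect_resample hρ (tgt a)]
      congr 1
      funext ω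
      rw [mul_assoc, mul_comm (∑ g, ρ g * ψ a g ω), Finset.mul_sum, Finset.mul_sum]
      refine Finset.sum_congr rfl fun g _ => ?_
      rw [Finset.prod_insert ha, hΦ, hψ, Function.update_self]
      have : ∏ l ∈ T, ψ l (Function.update ω (tgt a) g (tgt l)) (Function.update ω (tgt a) g) =
          ∏ l ∈ T, ψ l (ω (tgt l)) ω :=
        Finset.prod_congr rfl fun l hl => by
          rw [hψ, Function.update_of_ne]
          exact fun h => ha (htgt h ▸ hl)
      rw [this]
      ring
    rw [h1, ih _ (fun l g ω => by simp only [hΦ, hψ])]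
    congr 1
    funext ω
    rw [Finset.prod_insert ha]
    ring

/-- Markov's inequality. -/
theorem expect_ind_le_div (hρ : IsWeight ρ) {F : (ι → G) → ℝ} (hF : ∀ ω, 0 ≤ F ω) {c : ℝ}
    (hc : 0 < c) : expect ρ (fun ω => ind (c ≤ F ω)) ≤ expect ρ F / c := by
  rw [le_div_iff₀ hc, mul_comm, ← expect_const_mul]
  refine expect_mono hρ fun ω => ?_
  by_cases h : c ≤ F ω
  · rw [ind_of_true h, mul_one]; exact h
  · rw [ind_of_false h, mul_zero]; exact hF ω

end FiniteExpectation

section Labels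

/-! ### Forced values of gates -/

/-- A gate together with its inputs and its boolean function. -/
abbrev Gate (n : ℕ) : Type := InputPair n × BoolFn

/-- The partial knowledge `y` of a boolean value admits the value `b`. -/
def Compat (y : Option Bool) (b : Bool) : Prop := y = none ∨ y = some b

instance (y : Option Bool) (b : Bool) : Decidable (Compat y b) := by
  unfold Compat; infer_instance

/-- The value of `f` that is forced by the partial knowledge of its arguments, if any. -/
def forcedVal (f : BoolFn) (y z : Option Bool) : Option Bool :=
  if ∀ b c, Compat y b → Compat z c → f b c = true then some true
  else if ∀ b c, Compat y b → Compat z c → f b c = false then some false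
  else none

theorem forcedVal_sound {f : BoolFn} {y z : Option Bool} {v b c : Bool}
    (h : forcedVal f y z = some v) (hb : Compat y b) (hc : Compat z c) : f b c = v := by
  unfold forcedVal at h
  split_ifs at h with h1 h2
  · rw [h1 b c hb hc]; simpa using h
  · rw [h2 b c hb hc]; simpa using h

theorem exists_compat (y : Option Bool) : ∃ b, Compat y b := by
  cases y with
  | none => exact ⟨true, Or.inl rfl⟩
  | some b => exact ⟨b, Or.inr rfl⟩

theorem forcedVal_eq_some {f : BoolFn} {y z : Option Bool} {v : Bool}
    (h : ∀ b c, Compat y b → Compat z c → f b c = v) : forcedVal f y z = some v := by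
  unfold forcedVal
  cases v with
  | true => rw [if_pos h]
  | false =>
    rw [if_neg, if_pos h]
    intro h'
    obtain ⟨b, hb⟩ := exists_compat y
    obtain ⟨c, hc⟩ := exists_compat z
    simpa [h b c hb hc] using h' b c hb hc

/-- `y'` contains at least the information of `y`. -/
def Refines (y' y : Option Bool) : Prop := ∀ v, y = some v → y' = some v

theorem Compat.of_refines {y' y : Option Bool} (h : Refines y' y) {b : Bool}
    (hb : Compat y' b) : Compat y b := by
  cases y with
  | none => exact Or.inl rfl
  | some v =>
    rw [h v rfl] at hb
    rcases hb with hb | hb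
    · cases hb
    · exact Or.inr hb

/-- More knowledge leaves fewer admissible arguments, so a forced value stays forced. -/
theorem forcedVal_refines {f : BoolFn} {y' y z' z : Option Bool} (hy : Refines y' y)
    (hz : Refines z' z) : Refines (forcedVal f y' z') (forcedVal f y z) := fun _ hv =>
  forcedVal_eq_some fun _ _ hb hc =>
    forcedVal_sound hv (Compat.of_refines hy hb) (Compat.of_refines hz hc)

variable {n : ℕ}

/-- The automaton with the given gates. -/
def toAut (ω : Fin n → Gate n) : Automaton n := ⟨fun i => (ω i).1, fun i => (ω i).2⟩

/-- The value of gate `i` that is forced within `t` rounds when nothing is known about the gates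
in `S`. -/
def label (ω : Fin n → Gate n) (S : Finset (Fin n)) : ℕ → Fin n → Option Bool
  | 0, _ => none
  | t + 1, i => if i ∈ S then none else
      forcedVal (ω i).2 (label ω S t (ω i).1.1.1) (label ω S t (ω i).1.1.2)

/-- The in-neighbourhood of depth `t` of gate `i` avoids `S`. -/
def Fresh (ω : Fin n → Gate n) (S : Finset (Fin n)) : ℕ → Fin n → Prop
  | 0, i => i ∉ S
  | t + 1, i => i ∉ S ∧ Fresh ω S t (ω i).1.1.1 ∧ Fresh ω S t (ω i).1.1.2

theorem Fresh.mono {ω : Fin n → Gate n} {S S' : Finset (Fin n)} (hS : S ⊆ S') {t : ℕ} {i : Fin n}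
    (h : Fresh ω S' t i) : Fresh ω S t i := by
  induction t generalizing i with
  | zero => exact fun h' => h (hS h')
  | succ t ih => exact ⟨fun h' => h.1 (hS h'), ih h.2.1, ih h.2.2⟩

theorem Fresh.congr {ω ω' : Fin n → Gate n} {S : Finset (Fin n)} (hω : ∀ i ∉ S, ω i = ω' i)
    {t : ℕ} {i : Fin n} (h : Fresh ω S t i) : Fresh ω' S t i := by
  induction t generalizing i with
  | zero => exact h
  | succ t ih =>
    refine ⟨h.1, ?_⟩
    rw [← hω i h.1]
    exact ⟨ih h.2.1, ih h.2.2⟩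

/-- The recursion stops at `S` before reading the gate. This is the source of the independence used
when counting walks. -/
theorem label_congr {ω ω' : Fin n → Gate n} {S : Finset (Fin n)} (hω : ∀ i ∉ S, ω i = ω' i)
    (t : ℕ) (i : Fin n) : label ω S t i = label ω' S t i := by
  induction t generalizing i with
  | zero => rfl
  | succ t ih =>
    by_cases hi : i ∈ S
    · simp [label, hi]
    · simp only [label, hi, if_false, hω i hi, ih]

theorem Fresh.label_empty_congr {ω ω' : Fin n → Gate n} {S : Finset (Fin n)}
    (hω : ∀ i ∉ S, ω i = ω' i) {t : ℕ} {i : Fin n} (h : Fresh ω S t i) :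
    label ω ∅ t i = label ω' ∅ t i := by
  induction t generalizing i with
  | zero => rfl
  | succ t ih =>
    simp only [label, Finset.notMem_empty, if_false, ← hω i h.1, ih h.2.1, ih h.2.2]

theorem Fresh.label_eq {ω : Fin n → Gate n} {S : Finset (Fin n)} {t : ℕ} {i : Fin n}
    (h : Fresh ω S t i) : label ω S t i = label ω ∅ t i := by
  induction t generalizing i with
  | zero => rfl
  | succ t ih =>
    simp only [label, Finset.notMem_empty, if_false, h.1, ih h.2.1, ih h.2.2]

theorem label_refines (ω : Fin n → Gate n) (S : Finset (Fin n)) (t : ℕ) (i : Fin n) :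
    Refines (label ω ∅ t i) (label ω S t i) := by
  induction t generalizing i with
  | zero => intro v h; exact h
  | succ t ih =>
    by_cases hi : i ∈ S
    · intro v h; simp [label, hi] at h
    · simp only [label, Finset.notMem_empty, if_false, hi]
      exact forcedVal_refines (ih _) (ih _)

theorem stateAt_succ (B : Automaton n) (x : Fin n → Bool) (t : ℕ) :
    B.stateAt x (t + 1) = B.step (B.stateAt x t) := by
  simp only [Automaton.stateAt, Function.iterate_succ_apply']

/-- A forced gate has its forced value from time `t` on. -/
theorem compat_label_stateAt (ω : Fin n → Gate n) (x : Fin n → Bool) {t s : ℕ} (hts : t ≤ s)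
    (i : Fin n) : Compat (label ω ∅ t i) ((toAut ω).stateAt x s i) := by
  induction t generalizing i s with
  | zero => exact Or.inl rfl
  | succ t ih =>
    obtain ⟨s, rfl⟩ : ∃ s', s = s' + 1 := ⟨s - 1, by omega⟩
    cases h : label ω ∅ (t + 1) i with
    | none => exact Or.inl rfl
    | some v =>
      right
      simp only [label, Finset.notMem_empty, if_false] at h
      rw [stateAt_succ]
      exact congrArg some (forcedVal_sound h (ih (by omega) _) (ih (by omega) _)).symm

/-! ### Effective edges -/

/-- `f` depends on its first argument for some admissible second argument. -/
def EffFst (f : BoolFn) (z : Option Bool) : Prop := ∃ c, Compat z c ∧ f false c ≠ f true c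

/-- `f` depends on its second argument for some admissible first argument. -/
def EffSnd (f : BoolFn) (y : Option Bool) : Prop := ∃ b, Compat y b ∧ f b false ≠ f b true

/-- `j` is an input of the gate `g`, and `g` depends on it for some values of the other input that
are admissible for the labels `τ`. -/
def EffEdge (g : Gate n) (τ : Fin n → Option Bool) (j : Fin n) : Prop :=
  (g.1.1.1 = j ∧ EffFst g.2 (τ g.1.1.2)) ∨ (g.1.1.2 = j ∧ EffSnd g.2 (τ g.1.1.1))

/-- Forgetting labels can only create effective edges, so labels that ignore a set give upper
bounds. -/
theorem EffEdge.mono {g : Gate n} {τ' τ : Fin n → Option Bool} (h : ∀ i, Refines (τ' i) (τ i))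
    {j : Fin n} (hj : EffEdge g τ' j) : EffEdge g τ j := by
  rcases hj with ⟨h1, c, hc, h2⟩ | ⟨h1, c, hc, h2⟩
  · exact Or.inl ⟨h1, c, Compat.of_refines (h _) hc, h2⟩
  · exact Or.inr ⟨h1, c, Compat.of_refines (h _) hc, h2⟩

theorem eq_of_not_effFst {f : BoolFn} {z : Option Bool} (h : ¬ EffFst f z) {c : Bool}
    (hc : Compat z c) (b b' : Bool) : f b c = f b' c := by
  have : f false c = f true c := by
    by_contra h'
    exact h ⟨c, hc, h'⟩
  cases b <;> cases b' <;> simp [this]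

theorem eq_of_not_effSnd {f : BoolFn} {y : Option Bool} (h : ¬ EffSnd f y) {b : Bool}
    (hb : Compat y b) (c c' : Bool) : f b c = f b c' := by
  have : f b false = f b true := by
    by_contra h'
    exact h ⟨b, hb, h'⟩
  cases c <;> cases c' <;> simp [this]

/-- The next value of a gate only depends on its effective inputs. -/
theorem fn_eq_of_effEdge {g : Gate n} {τ : Fin n → Option Bool} {y y' : Fin n → Bool}
    (hy : ∀ i, Compat (τ i) (y i)) (hy' : ∀ i, Compat (τ i) (y' i))
    (h : ∀ j, EffEdge g τ j → y j = y' j) :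
    g.2 (y g.1.1.1) (y g.1.1.2) = g.2 (y' g.1.1.1) (y' g.1.1.2) := by
  -- Change one argument at a time: the mixed pair is still admissible for the labels.
  have h1 : g.2 (y g.1.1.1) (y g.1.1.2) = g.2 (y' g.1.1.1) (y g.1.1.2) := by
    by_cases hf : EffFst g.2 (τ g.1.1.2)
    · rw [h _ (Or.inl ⟨rfl, hf⟩)]
    · exact eq_of_not_effFst hf (hy _) _ _
  rw [h1]
  by_cases hf : EffSnd g.2 (τ g.1.1.1)
  · rw [h _ (Or.inr ⟨rfl, hf⟩)]
  · exact eq_of_not_effSnd hf (hy' _) _ _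

end Labels

section Periodicity

/-! ### Periods of networks and their cyclic vertices -/

section Period

variable {V : Type*}

/-- A closed walk through `i` contains one that repeats no vertex. -/
theorem exists_simple_closed_walk {H : V → V → Prop} {i : V} (h : Relation.TransGen H i i) :
    ∃ k, 1 ≤ k ∧ ∃ u : ℕ → V, u 0 = i ∧ u k = i ∧ (∀ l < k, H (u l) (u (l + 1))) ∧
      ∀ a b, 1 ≤ a → a < b → b ≤ k → u a ≠ u b := by
  classical
  have hwalk : ∀ j, Relation.TransGen H j i → ∃ k, 1 ≤ k ∧ ∃ u : ℕ → V, u 0 = j ∧ u k = i ∧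
      ∀ l < k, H (u l) (u (l + 1)) := by
    intro j hj
    induction hj using Relation.TransGen.head_induction_on with
    | single hab =>
      rename_i a
      refine ⟨1, le_rfl, fun l => if l = 0 then a else i, by simp, by simp, ?_⟩
      intro l hl
      obtain rfl : l = 0 := by omega
      simpa using hab
    | head hab _ ih =>
      rename_i a c _
      obtain ⟨k, _, u, hu0, huk, hu⟩ := ih
      refine ⟨k + 1, by omega, fun l => if l = 0 then a else u (l - 1), by simp, by simp [huk], ?_⟩
      intro l hl
      rcases Nat.eq_zero_or_pos l with rfl | hl0
      · simpa [hu0] using hab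
      · have := hu (l - 1) (by omega)
        rw [Nat.sub_add_cancel hl0] at this
        simpa [hl0.ne'] using this
  have hex := hwalk i h
  obtain ⟨hk, u, hu0, huk, hu⟩ := Nat.find_spec hex
  set k := Nat.find hex with hkdef
  refine ⟨k, hk, u, hu0, huk, hu, fun a b ha hab hb heq => ?_⟩
  -- Cutting out the segment from `a` to `b` gives a shorter closed walk, against the minimality of
  -- `k`. It is nonempty because `1 ≤ a`.
  refine Nat.find_min hex (m := k - (b - a)) (by omega) ⟨by omega,
    fun l => if l ≤ a then u l else u (l + (b - a)), by simp [hu0], ?_, ?_⟩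
  · by_cases hka : k - (b - a) ≤ a
    · have : b = k := by omega
      simp only [hka, if_true]
      rw [show k - (b - a) = a by omega, heq, this, huk]
    · simp only [hka, if_false]
      rw [Nat.sub_add_cancel (by omega), huk]
  · intro l hl
    by_cases h1 : l + 1 ≤ a
    · simp only [h1, show l ≤ a by omega, if_true]
      exact hu l (by omega)
    · by_cases h2 : l ≤ a
      · obtain rfl : l = a := by omega
        simp only [le_refl, h1, if_true, if_false]
        rw [heq, show l + 1 + (b - l) = b + 1 by omega]
        exact hu b (by omega)
      · simp only [h1, h2, if_false]
        rw [show l + 1 + (b - a) = l + (b - a) + 1 by omega]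
        exact hu _ (by omega)

variable [Fintype V] [DecidableEq V]

open Classical in
/-- A trajectory in which eventually every vertex is determined by its in-neighbours is eventually
periodic on every set that is closed under in-neighbours, with a period bounded in terms of the
number of vertices on cycles. -/
theorem eventually_periodic_of_closed {H : V → V → Prop} {z : ℕ → V → Bool} {s₀ : ℕ}
    (hdet : ∀ s s', s₀ ≤ s → s₀ ≤ s' → ∀ i, (∀ j, H j i → z s j = z s' j) →
      z (s + 1) i = z (s' + 1) i) (L : Finset V) (hL : ∀ i ∈ L, ∀ j, H j i → j ∈ L) :
    ∃ T, 1 ≤ T ∧ T ≤ 2 ^ (L.filter fun i => Relation.TransGen H i i).card ∧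
      ∃ s₁, s₀ ≤ s₁ ∧ ∀ s, s₁ ≤ s → ∀ i ∈ L, z (s + T) i = z s i := by
  induction L using Finset.strongInduction with
  | H L ih =>
    rcases L.eq_empty_or_nonempty with rfl | hne
    · exact ⟨1, le_rfl, by simp, s₀, le_rfl, by simp⟩
    let desc : V → Finset V := fun i => L.filter fun j => Relation.ReflTransGen H i j
    -- A vertex with fewest descendants lies in a terminal strong component, which is then all of
    -- `desc i`. Removing it leaves a set closed under in-neighbours.
    obtain ⟨i, hiL, hmin⟩ := Finset.exists_min_image L (fun i => (desc i).card) hne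
    have hiC : i ∈ desc i := Finset.mem_filter.2 ⟨hiL, .refl⟩
    have hback : ∀ j ∈ desc i, Relation.ReflTransGen H j i := by
      intro j hj
      have hj' := Finset.mem_filter.1 hj
      have hsub : desc j ⊆ desc i := fun m hm =>
        Finset.mem_filter.2 ⟨(Finset.mem_filter.1 hm).1, hj'.2.trans (Finset.mem_filter.1 hm).2⟩
      have heq := Finset.eq_of_subset_of_card_le hsub (hmin j hj'.1)
      rw [← heq] at hiC
      exact (Finset.mem_filter.1 hiC).2
    have hsubL : desc i ⊆ L := Finset.filter_subset _ _
    have hclosed : ∀ m ∈ L \ desc i, ∀ j, H j m → j ∈ L \ desc i := by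
      intro m hm j hj
      obtain ⟨hmL, hmC⟩ := Finset.mem_sdiff.1 hm
      refine Finset.mem_sdiff.2 ⟨hL m hmL j hj, fun hjC => hmC ?_⟩
      exact Finset.mem_filter.2 ⟨hmL, (Finset.mem_filter.1 hjC).2.tail hj⟩
    obtain ⟨T, hT1, hT2, s₁, hs₁, hper⟩ := ih (L \ desc i)
      (Finset.sdiff_ssubset hsubL ⟨i, hiC⟩) hclosed
    have hmul : ∀ k s, s₁ ≤ s → ∀ j ∈ L \ desc i, z (s + k * T) j = z s j := by
      intro k
      induction k with
      | zero => intro s _ j _; simp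
      | succ k ihk =>
        intro s hs j hj
        rw [show s + (k + 1) * T = (s + k * T) + T by ring, hper _ (by omega) j hj, ihk s hs j hj]
    by_cases hR : ∀ j ∈ desc i, Relation.TransGen H j j
    -- All vertices of the component are cyclic. The rest has period `T`, so sample the component at
    -- multiples of `T`: by pigeonhole two of `2 ^ (desc i).card + 1` samples agree, and determinism
    -- propagates this to all later times.
    · obtain ⟨a, b, hab, heq⟩ := Fintype.exists_ne_map_eq_of_card_lt
        (fun (m : Fin (2 ^ (desc i).card + 1)) (j : desc i) => z (s₁ + m * T) j) (by simp)
      wlog hlt : a < b generalizing a b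
      · exact this b a hab.symm heq.symm (lt_of_le_of_ne (not_lt.1 hlt) hab.symm)
      have hlt' : (a : ℕ) < b := hlt
      refine ⟨(b - a) * T, Nat.mul_pos (by omega) (by omega), ?_, s₁ + a * T, by omega, ?_⟩
      · have hcard : (L.filter fun i => Relation.TransGen H i i).card =
            ((L \ desc i).filter fun i => Relation.TransGen H i i).card + (desc i).card := by
          rw [← Finset.card_union_of_disjoint]
          · congr 1
            ext j
            simp only [Finset.mem_union, Finset.mem_filter, Finset.mem_sdiff]
            constructor
            · rintro ⟨h1, h2⟩
              by_cases hj : j ∈ desc i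
              · exact Or.inr hj
              · exact Or.inl ⟨⟨h1, hj⟩, h2⟩
            · rintro (⟨⟨h1, -⟩, h2⟩ | h)
              · exact ⟨h1, h2⟩
              · exact ⟨hsubL h, hR j h⟩
          · exact Finset.disjoint_left.2 fun j hj hj' =>
              (Finset.mem_sdiff.1 (Finset.mem_filter.1 hj).1).2 hj'
        rw [hcard, pow_add, mul_comm]
        exact Nat.mul_le_mul hT2 (by omega)
      · intro s hs
        induction s, hs using Nat.le_induction with
        | base =>
          intro j hj
          by_cases hjC : j ∈ desc i
          · have := congrFun heq ⟨j, hjC⟩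
            simp only at this
            rw [this]
            congr 1
            rw [Nat.sub_mul]
            have := Nat.mul_le_mul_right T hlt'.le
            omega
          · exact hmul _ _ (by omega) j (Finset.mem_sdiff.2 ⟨hj, hjC⟩)
        | succ s hs ihs =>
          intro j hj
          rw [show s + 1 + (b - a) * T = (s + (b - a) * T) + 1 by ring]
          exact hdet _ _ (by omega) (by omega) j fun m hm => ihs m (hL j hj m hm)
    -- A non-cyclic vertex is a whole strong component by itself. It copies the periodicity of its
    -- in-neighbours one step later, so the period does not grow.
    · push Not at hR
      obtain ⟨j, hjC, hj⟩ := hR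
      have hsingle : ∀ m ∈ desc i, m = j := by
        intro m hm
        have h1 : Relation.ReflTransGen H j m := (hback j hjC).trans (Finset.mem_filter.1 hm).2
        have h2 : Relation.ReflTransGen H m j := (hback m hm).trans (Finset.mem_filter.1 hjC).2
        rcases Relation.reflTransGen_iff_eq_or_transGen.1 h1 with h | h
        · exact h
        · exact absurd (h.trans_left h2) hj
      refine ⟨T, hT1, hT2.trans (Nat.pow_le_pow_right (by omega) (Finset.card_le_card
        (Finset.filter_subset_filter _ Finset.sdiff_subset))), s₁ + 1, by omega, ?_⟩
      intro s hs m hm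
      by_cases hmC : m ∈ desc i
      · obtain ⟨s, rfl⟩ : ∃ s', s = s' + 1 := ⟨s - 1, by omega⟩
        rw [show s + 1 + T = (s + T) + 1 by ring]
        refine hdet _ _ (by omega) (by omega) m fun h hh => hper s (by omega) h ?_
        refine Finset.mem_sdiff.2 ⟨hL m hm h hh, fun hhC => hj ?_⟩
        rw [hsingle m hmC, hsingle h hhC] at hh
        exact .single hh
      · exact hper s (by omega) m (Finset.mem_sdiff.2 ⟨hm, hmC⟩)

end Period

variable {n : ℕ}

/-! ### State cycles bounded by eventual periods -/

theorem stateAt_add_eq (B : Automaton n) (x : Fin n → Bool) {s s' : ℕ}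
    (h : B.stateAt x s = B.stateAt x s') (k : ℕ) :
    B.stateAt x (s + k) = B.stateAt x (s' + k) := by
  induction k with
  | zero => exact h
  | succ k ih => rw [← add_assoc, ← add_assoc, stateAt_succ, stateAt_succ, ih]

/-- A state cycle is at most as large as any eventual period. -/
theorem ncard_stateCycle_le (B : Automaton n) (x : Fin n → Bool) {T s₁ : ℕ} (hT : 1 ≤ T)
    (hper : ∀ s, s₁ ≤ s → B.stateAt x (s + T) = B.stateAt x s) :
    (B.stateCycle x).ncard ≤ T := by
  have h1 : B.firstRepeat x ∈ {t₁ | ∃ t₀ < t₁, B.stateAt x t₀ = B.stateAt x t₁} :=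
    Nat.sInf_mem ⟨s₁ + T, s₁, by omega, (hper s₁ le_rfl).symm⟩
  have h2 : B.cycleStart x ∈
      {t₀ | t₀ < B.firstRepeat x ∧ B.stateAt x t₀ = B.stateAt x (B.firstRepeat x)} := by
    obtain ⟨t₀, h, h'⟩ := h1
    exact Nat.sInf_mem ⟨t₀, h, h'⟩
  obtain ⟨hlt, heq⟩ := h2
  set t₀ := B.cycleStart x
  set d := B.firstRepeat x - t₀ with hd
  have hshift : ∀ k t, t₀ ≤ t → B.stateAt x (t + k * d) = B.stateAt x t := by
    intro k
    induction k with
    | zero => intro t _; simp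
    | succ k ih =>
      intro t ht
      rw [show t + (k + 1) * d = B.firstRepeat x + (t - t₀ + k * d) by
        rw [add_mul]; omega, ← stateAt_add_eq B x heq,
        show t₀ + (t - t₀ + k * d) = t + k * d by omega, ih t ht]
  have hred : ∀ m s, s₁ ≤ s → s < s₁ + m → ∃ r < T, B.stateAt x s = B.stateAt x (s₁ + r) := by
    intro m
    induction m with
    | zero => intro s h h'; omega
    | succ m ih =>
      intro s h h'
      by_cases hsT : s < s₁ + T
      · exact ⟨s - s₁, by omega, by rw [Nat.add_sub_cancel' h]⟩
      · obtain ⟨r, hr, hr'⟩ := ih (s - T) (by omega) (by omega)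
        refine ⟨r, hr, ?_⟩
        rw [← hr', ← hper (s - T) (by omega), Nat.sub_add_cancel (by omega)]
  have hsub : B.stateCycle x ⊆
      (((Finset.range T).image fun r => B.stateAt x (s₁ + r) : Finset (Fin n → Bool)) :
        Set (Fin n → Bool)) := by
    rintro y ⟨t, ht, rfl⟩
    have hd1 : 1 ≤ d := by omega
    have hs1 : s₁ ≤ s₁ * d := Nat.le_mul_of_pos_right _ hd1
    -- Going round the cycle `s₁` times leaves the state unchanged and moves the time past `s₁`.
    obtain ⟨r, hr, hr'⟩ := hred (t + s₁ * d + 1) (t + s₁ * d) (by omega) (by omega)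
    rw [hshift _ _ ht] at hr'
    simp only [Finset.coe_image, Set.mem_image, Finset.mem_coe, Finset.mem_range]
    exact ⟨r, hr, hr'.symm⟩
  calc (B.stateCycle x).ncard ≤ _ := Set.ncard_le_ncard hsub (Finset.finite_toSet _)
    _ = _ := Set.ncard_coe_finset _
    _ ≤ (Finset.range T).card := Finset.card_image_le
    _ = T := Finset.card_range T

theorem ncard_stateCycle_le_two_pow (B : Automaton n) (x : Fin n → Bool) :
    (B.stateCycle x).ncard ≤ 2 ^ n := by
  calc (B.stateCycle x).ncard ≤ (Set.univ : Set (Fin n → Bool)).ncard :=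
        Set.ncard_le_ncard (Set.subset_univ _) Set.finite_univ
    _ = 2 ^ n := by rw [Set.ncard_univ, Nat.card_eq_fintype_card]; simp

/-- Gate `j` is an effective input of gate `i` with respect to the labels after `t` rounds. -/
def EffRel (ω : Fin n → Gate n) (t : ℕ) (j i : Fin n) : Prop := EffEdge (ω i) (label ω ∅ t) j

open Classical in
/-- The gates on cycles of effective edges. -/
def cyclicGates (ω : Fin n → Gate n) (t : ℕ) : Finset (Fin n) :=
  Finset.univ.filter fun i => Relation.TransGen (EffRel ω t) i i

/-- After time `t` all states are compatible with the labels, so effective inputs alone determine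
the next value and the periodicity lemma applies to the effective digraph. -/
theorem ncard_stateCycle_le_cyclicGates (ω : Fin n → Gate n) (t : ℕ) (x : Fin n → Bool) :
    ((toAut ω).stateCycle x).ncard ≤ 2 ^ (cyclicGates ω t).card := by
  obtain ⟨T, hT1, hT2, s₁, -, hper⟩ := eventually_periodic_of_closed (H := EffRel ω t)
    (z := (toAut ω).stateAt x) (s₀ := t) (by
      intro s s' hs hs' i h
      rw [stateAt_succ, stateAt_succ]
      exact fn_eq_of_effEdge (compat_label_stateAt ω x hs) (compat_label_stateAt ω x hs') h)
    Finset.univ (by simp)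
  exact (ncard_stateCycle_le _ x hT1 fun s hs => funext fun i => hper s hs i
    (Finset.mem_univ i)).trans (by simpa only [cyclicGates] using hT2)

end Periodicity

section LimitLaw

/-! ### The limit law of the labels -/

variable {w : BoolFn → ℝ}

/-- The law of the label after `t` rounds in the limit of many gates. -/
def law (w : BoolFn → ℝ) : ℕ → Option Bool → ℝ
  | 0, v => if v = none then 1 else 0
  | t + 1, v => ∑ f, w f * ∑ y, ∑ z, if forcedVal f y z = v then law w t y * law w t z else 0

/-- The probability that `f` takes the forced value `v` when its arguments are independently
known to be `false`, `true`, or unknown, with probabilities `r`, `r`, `1 - 2 * r`. -/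
def forcedProb (r : ℝ) (f : BoolFn) (v : Bool) : ℝ :=
  ∑ y : Option Bool, ∑ z : Option Bool, if forcedVal f y z = some v then
    (y.elim (1 - 2 * r) fun _ => r) * (z.elim (1 - 2 * r) fun _ => r) else 0

/-- The boolean function with the given truth table. -/
def mkFn (a b c d : Bool) : BoolFn := fun x y => cond x (cond y a b) (cond y c d)

theorem exists_eq_mkFn (f : BoolFn) : ∃ a b c d, f = mkFn a b c d :=
  ⟨f true true, f true false, f false true, f false false, by
    funext x y; cases x <;> cases y <;> rfl⟩

/-- The forced probability is `1` for a constant, `(2 * r) ^ 2` for a non-canalyzing function (both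
arguments must be known), and `2 * r` otherwise: for AND it is `(2 * r - r ^ 2) + r ^ 2`. -/
theorem forcedProb_add (r : ℝ) (f : BoolFn) :
    forcedProb r f true + forcedProb r f false =
      2 * r + (if IsClassA f then 1 else 0) * (1 - 2 * r) +
        (if IsClassC f then 1 else 0) * ((2 * r) ^ 2 - 2 * r) := by
  obtain ⟨a, b, c, d, rfl⟩ := exists_eq_mkFn f
  cases a <;> cases b <;> cases c <;> cases d <;>
    simp +decide [forcedProb, Fintype.sum_option] <;> ring

theorem forcedProb_negFn (r : ℝ) (f : BoolFn) (v : Bool) :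
    forcedProb r (negFn f) v = forcedProb r f (!v) := by
  have h : ∀ (f : BoolFn) (v : Bool) (y z : Option Bool),
      forcedVal (negFn f) y z = some v ↔ forcedVal f y z = some (!v) := by
    intro f v y z
    revert f v y z
    decide
  simp only [forcedProb, h]

/-- Functions in `B₁` and `C` treat the two values alike on symmetric inputs, so symmetry of the
weights under negation is needed only on `A` and `B₂`. -/
theorem forcedProb_eq (r : ℝ) (f : BoolFn) (hf : ¬ (IsClassA f ∨ IsClassB₂ f)) :
    forcedProb r f true = forcedProb r f false := by
  obtain ⟨a, b, c, d, rfl⟩ := exists_eq_mkFn f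
  revert hf
  cases a <;> cases b <;> cases c <;> cases d <;>
    simp +decide [forcedProb, Fintype.sum_option]

/-- The terms of `f` and `τ f` cancel; where the weights need not agree, `D` vanishes. -/
theorem sum_mul_eq_zero_of_involutive {τ : BoolFn → BoolFn} (hτ : Function.Involutive τ)
    {D : BoolFn → ℝ} (hD : ∀ f, D (τ f) = - D f) (hw : ∀ f, D f = 0 ∨ w f = w (τ f)) :
    ∑ f, w f * D f = 0 := by
  have h1 : ∑ f, w f * D f = ∑ f, w (τ f) * D (τ f) :=
    (Equiv.sum_comp hτ.toPerm fun f => w f * D f).symm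
  have h2 : ∑ f, w (τ f) * D (τ f) = - ∑ f, w f * D f := by
    rw [← Finset.sum_neg_distrib]
    refine Finset.sum_congr rfl fun f _ => ?_
    rcases hw f with h | h
    · rw [hD, h]; ring
    · rw [hD, ← h]; ring
  linarith

theorem negFn_involutive : Function.Involutive negFn := fun f => by
  funext x y; simp [negFn]

theorem swapFn_involutive : Function.Involutive swapFn := fun _ => rfl

theorem sum_mul_ite {P : BoolFn → Prop} [DecidablePred P] :
    ∑ f, w f * (if P f then 1 else 0) = ∑ f with P f, w f := by
  rw [Finset.sum_filter]
  exact Finset.sum_congr rfl fun f _ => by split_ifs <;> simp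

theorem sum_mul_class (hw : IsDistribution w) (α β γ : ℝ) :
    ∑ f, w f * (α + (if IsClassA f then 1 else 0) * β + (if IsClassC f then 1 else 0) * γ) =
      α + probA w * β + probC w * γ := by
  simp only [mul_add, ← mul_assoc, Finset.sum_add_distrib, ← Finset.sum_mul, sum_mul_ite,
    hw.sum_eq_one, one_mul, probA, probC]

/-- The probability that a gate is not forced after `t` rounds, in the limit law. -/
def unforced (w : BoolFn → ℝ) (t : ℕ) : ℝ := law w t none

theorem sum_law (hw : IsDistribution w) (t : ℕ) : ∑ v, law w t v = 1 := by
  induction t with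
  | zero => simp [law]
  | succ t ih =>
    simp only [law]
    rw [Finset.sum_comm]
    simp only [← Finset.mul_sum]
    have : ∀ f : BoolFn, ∑ v, ∑ y, ∑ z,
        (if forcedVal f y z = v then law w t y * law w t z else 0) = 1 := by
      intro f
      rw [Finset.sum_comm]
      have : ∀ y, ∑ v, ∑ z, (if forcedVal f y z = v then law w t y * law w t z else 0) =
          law w t y := by
        intro y
        rw [Finset.sum_comm]
        simp only [Finset.sum_ite_eq, Finset.mem_univ, if_true]
        rw [← Finset.mul_sum, ih, mul_one]
      simp only [this, ih]
    simp only [this, mul_one, hw.sum_eq_one]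

theorem law_nonneg (hw : IsDistribution w) (t : ℕ) (v : Option Bool) : 0 ≤ law w t v := by
  induction t generalizing v with
  | zero => simp only [law]; split_ifs <;> norm_num
  | succ t ih =>
    simp only [law]
    refine Finset.sum_nonneg fun f _ => mul_nonneg (hw.nonneg f) ?_
    refine Finset.sum_nonneg fun y _ => Finset.sum_nonneg fun z _ => ?_
    split_ifs
    · exact mul_nonneg (ih y) (ih z)
    · exact le_rfl

theorem law_le_one (hw : IsDistribution w) (t : ℕ) (v : Option Bool) : law w t v ≤ 1 := by
  rw [← sum_law hw t]
  exact Finset.single_le_sum (fun v _ => law_nonneg hw t v) (Finset.mem_univ v)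

theorem law_succ_of_symm {t : ℕ} {r : ℝ} (h : ∀ b, law w t (some b) = r)
    (h' : law w t none = 1 - 2 * r) (v : Bool) :
    law w (t + 1) (some v) = ∑ f, w f * forcedProb r f v := by
  have : ∀ y, law w t y = y.elim (1 - 2 * r) fun _ => r := by
    intro y; cases y with
    | none => exact h'
    | some b => exact h b
  simp only [law, forcedProb, this]

theorem law_symm (hw : IsDistribution w) (hsymm : IsSymmetric w) (t : ℕ) :
    ∃ r, (∀ b, law w t (some b) = r) ∧ law w t none = 1 - 2 * r ∧ unforced w t = 1 - 2 * r := by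
  induction t with
  | zero => exact ⟨0, by simp [law], by simp [law], by simp [unforced, law]⟩
  | succ t ih =>
    obtain ⟨r, h1, h2, -⟩ := ih
    have key : law w (t + 1) (some true) = law w (t + 1) (some false) := by
      rw [law_succ_of_symm h1 h2, law_succ_of_symm h1 h2, ← sub_eq_zero,
        ← Finset.sum_sub_distrib]
      simp only [← mul_sub]
      refine sum_mul_eq_zero_of_involutive negFn_involutive
        (fun f => by rw [forcedProb_negFn, forcedProb_negFn]; simp) fun f => ?_
      by_cases hf : IsClassA f ∨ IsClassB₂ f
      · exact Or.inr (hsymm.neg f hf)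
      · exact Or.inl (sub_eq_zero.2 (forcedProb_eq r f hf))
    have hs := sum_law hw (t + 1)
    rw [Fintype.sum_option, Fintype.sum_bool, ← key] at hs
    refine ⟨law w (t + 1) (some true), ?_, by linarith, by rw [unforced]; linarith⟩
    intro b; cases b
    · exact key.symm
    · rfl

theorem probC_nonneg (hw : IsDistribution w) : 0 ≤ probC w :=
  Finset.sum_nonneg fun f _ => hw.nonneg f

theorem probA_le_one (hw : IsDistribution w) : probA w ≤ 1 := by
  rw [← hw.sum_eq_one]
  exact Finset.sum_le_sum_of_subset_of_nonneg (Finset.filter_subset _ _) fun f _ _ => hw.nonneg f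

theorem unforced_nonneg (hw : IsDistribution w) (t : ℕ) : 0 ≤ unforced w t := law_nonneg hw t _

theorem unforced_succ_le (hw : IsDistribution w) (hsymm : IsSymmetric w) (t : ℕ) :
    unforced w (t + 1) ≤ (1 - probA w + probC w) * unforced w t := by
  obtain ⟨r, h1, h2, h3⟩ := law_symm hw hsymm t
  have hs := sum_law hw (t + 1)
  rw [Fintype.sum_option, Fintype.sum_bool, law_succ_of_symm h1 h2, law_succ_of_symm h1 h2,
    ← Finset.sum_add_distrib] at hs
  simp only [← mul_add, forcedProb_add] at hs
  rw [sum_mul_class hw] at hs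
  rw [unforced, h3]
  -- The discarded term is `c * u ^ 2` with `u = 1 - 2 * r`.
  nlinarith [probC_nonneg hw, mul_nonneg (probC_nonneg hw) (sq_nonneg (1 - 2 * r))]

theorem exists_unforced_le (hw : IsDistribution w) (hsymm : IsSymmetric w)
    (hac : probC w < probA w) {δ : ℝ} (hδ : 0 < δ) : ∃ t, unforced w t ≤ δ := by
  have h0 : 0 ≤ 1 - probA w + probC w := by linarith [probA_le_one hw, probC_nonneg hw]
  have h : ∀ t, unforced w t ≤ (1 - probA w + probC w) ^ t := by
    intro t
    induction t with
    | zero => simp [unforced, law]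
    | succ t ih =>
      rw [pow_succ']
      exact (unforced_succ_le hw hsymm t).trans (mul_le_mul_of_nonneg_left ih h0)
  obtain ⟨t, ht⟩ := exists_pow_lt_of_lt_one hδ (show 1 - probA w + probC w < 1 by linarith)
  exact ⟨t, (h t).trans ht.le⟩

/-! ### The mean number of effective inputs -/

/-- The probability that the first input of a gate is effective when the second has label `z`. -/
def effProbFst (w : BoolFn → ℝ) (z : Option Bool) : ℝ := ∑ f, w f * ind (EffFst f z)

/-- The probability that the second input of a gate is effective when the first has label `y`. -/
def effProbSnd (w : BoolFn → ℝ) (y : Option Bool) : ℝ := ∑ f, w f * ind (EffSnd f y)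

theorem effFst_some (f : BoolFn) (c : Bool) : EffFst f (some c) ↔ f false c ≠ f true c := by
  simp [EffFst, Compat]

theorem effFst_swapFn (f : BoolFn) (z : Option Bool) : EffFst (swapFn f) z ↔ EffSnd f z := Iff.rfl

/-- The excess of the number of values of the second argument for which the first one matters. -/
def excess (f : BoolFn) : ℝ :=
  ind (EffFst f (some false)) + ind (EffFst f (some true)) -
    (1 + (if IsClassA f then 1 else 0) * (-1) + (if IsClassC f then 1 else 0) * 1)

theorem excess_eq_zero {f : BoolFn} (hf : ¬ IsClassB₁ f) : excess f = 0 := by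
  obtain ⟨a, b, c, d, rfl⟩ := exists_eq_mkFn f
  revert hf
  simp only [excess, ind, effFst_some]
  cases a <;> cases b <;> cases c <;> cases d <;> simp +decide

/-- For `B₁` the excess is `1` or `-1` according to which argument matters, and swapping flips it.
Elsewhere it is `0`. -/
theorem excess_swapFn (f : BoolFn) : excess (swapFn f) = - excess f := by
  obtain ⟨a, b, c, d, rfl⟩ := exists_eq_mkFn f
  simp only [excess, ind, effFst_some]
  cases a <;> cases b <;> cases c <;> cases d <;> simp +decide

theorem sum_excess (hsymm : IsSymmetric w) : ∑ f, w f * excess f = 0 := by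
  refine sum_mul_eq_zero_of_involutive swapFn_involutive excess_swapFn fun f => ?_
  by_cases hf : IsClassB₁ f
  · exact Or.inr (hsymm.swap f hf)
  · exact Or.inl (excess_eq_zero hf)

theorem effProbFst_add (hw : IsDistribution w) (hsymm : IsSymmetric w) :
    effProbFst w (some false) + effProbFst w (some true) = 1 - probA w + probC w := by
  have h : effProbFst w (some false) + effProbFst w (some true) = ∑ f, w f * excess f +
      ∑ f, w f * (1 + (if IsClassA f then 1 else 0) * (-1) +
        (if IsClassC f then 1 else 0) * 1) := by
    rw [effProbFst, effProbFst, ← Finset.sum_add_distrib, ← Finset.sum_add_distrib]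
    exact Finset.sum_congr rfl fun f _ => by rw [excess]; ring
  rw [h, sum_excess hsymm, sum_mul_class hw]
  ring

theorem effProbSnd_add (hw : IsDistribution w) (hsymm : IsSymmetric w) :
    effProbSnd w (some false) + effProbSnd w (some true) = 1 - probA w + probC w := by
  have hA : ∀ f, IsClassA (swapFn f) ↔ IsClassA f := by decide
  have hC : ∀ f, IsClassC (swapFn f) ↔ IsClassC f := by decide
  have h : effProbSnd w (some false) + effProbSnd w (some true) = - ∑ f, w f * excess f +
      ∑ f, w f * (1 + (if IsClassA f then 1 else 0) * (-1) +
        (if IsClassC f then 1 else 0) * 1) := by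
    rw [effProbSnd, effProbSnd, ← Finset.sum_add_distrib, ← Finset.sum_neg_distrib,
      ← Finset.sum_add_distrib]
    refine Finset.sum_congr rfl fun f _ => ?_
    rw [← mul_neg, ← excess_swapFn, excess]
    simp only [hA, hC, effFst_swapFn]
    ring
  rw [h, sum_excess hsymm, sum_mul_class hw]
  ring

theorem sum_mul_ind_mem (hw : IsDistribution w) (P : BoolFn → Prop) :
    0 ≤ ∑ f, w f * ind (P f) ∧ ∑ f, w f * ind (P f) ≤ 1 := by
  refine ⟨Finset.sum_nonneg fun f _ => mul_nonneg (hw.nonneg f) (ind_nonneg _), ?_⟩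
  rw [← hw.sum_eq_one]
  exact Finset.sum_le_sum fun f _ => mul_le_of_le_one_right (hw.nonneg f) (ind_le_one _)

/-- Each forced value has the same mass, at most `1 / 2`; the unknown label costs at most its own
mass. -/
theorem sum_law_mul_le (hw : IsDistribution w) (hsymm : IsSymmetric w) (t : ℕ)
    {W : Option Bool → ℝ} (hW : W none ≤ 1)
    (hW0 : 0 ≤ W (some false)) (hW1 : 0 ≤ W (some true))
    (h : W (some false) + W (some true) = 1 - probA w + probC w) :
    ∑ v, law w t v * W v ≤ (1 - probA w + probC w) / 2 + unforced w t := by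
  obtain ⟨r, h1, h2, h3⟩ := law_symm hw hsymm t
  rw [Fintype.sum_option, Fintype.sum_bool, h1, h1, ← unforced]
  have hu := unforced_nonneg hw t
  nlinarith

theorem sum_law_effProb_le (hw : IsDistribution w) (hsymm : IsSymmetric w) (t : ℕ) :
    ∑ v, law w t v * effProbFst w v + ∑ v, law w t v * effProbSnd w v ≤
      1 - probA w + probC w + 2 * unforced w t := by
  have h1 := sum_law_mul_le hw hsymm t (sum_mul_ind_mem hw _).2 (sum_mul_ind_mem hw _).1
    (sum_mul_ind_mem hw _).1 (effProbFst_add hw hsymm)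
  have h2 := sum_law_mul_le hw hsymm t (sum_mul_ind_mem hw _).2 (sum_mul_ind_mem hw _).1
    (sum_mul_ind_mem hw _).1 (effProbSnd_add hw hsymm)
  change ∑ v, law w t v * effProbFst w v ≤ _ at h1
  change ∑ v, law w t v * effProbSnd w v ≤ _ at h2
  linarith

end LimitLaw

section JointLaw

variable {w : BoolFn → ℝ} {n : ℕ}

/-! ### The distribution of a gate -/

/-- The probability of a gate. -/
def gateWeight (w : BoolFn → ℝ) (n : ℕ) (g : Gate n) : ℝ := 1 / (n.choose 2 : ℝ) * w g.2

theorem card_inputPair (n : ℕ) : Fintype.card (InputPair n) = n.choose 2 := by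
  rw [Fintype.card_subtype, Finset.card_filter, Fintype.sum_prod_type_right]
  have : ∀ k : Fin n, ∑ j : Fin n, (if j < k then 1 else 0) = (k : ℕ) := by
    intro k
    rw [← Finset.card_filter, Finset.filter_gt_eq_Iio, Fin.card_Iio]
  simp only [this]
  rw [Fin.sum_univ_eq_sum_range (fun k => k), Finset.sum_range_id, Nat.choose_two_right]

theorem choose_two_pos (hn : 2 ≤ n) : (0 : ℝ) < n.choose 2 := by
  exact_mod_cast Nat.choose_pos hn

theorem one_div_choose_two_le (hn : 2 ≤ n) : 1 / (n.choose 2 : ℝ) ≤ 4 / (n : ℝ) ^ 2 := by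
  have hn' : (2 : ℝ) ≤ n := by exact_mod_cast hn
  rw [div_le_div_iff₀ (choose_two_pos hn) (by positivity), Nat.cast_choose_two]
  nlinarith

theorem sum_gateWeight_mul (F : Gate n → ℝ) :
    ∑ g, gateWeight w n g * F g =
      1 / (n.choose 2 : ℝ) * ∑ p, ∑ f, w f * F (p, f) := by
  rw [Fintype.sum_prod_type, Finset.mul_sum]
  refine Finset.sum_congr rfl fun p _ => ?_
  rw [Finset.mul_sum]
  exact Finset.sum_congr rfl fun f _ => by rw [gateWeight]; ring

theorem isWeight_gateWeight (hw : IsDistribution w) (hn : 2 ≤ n) : IsWeight (gateWeight w n) where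
  nonneg g := mul_nonneg (by positivity) (hw.nonneg _)
  sum_eq_one := by
    have h := sum_gateWeight_mul (w := w) (fun _ : Gate n => (1 : ℝ))
    simp only [mul_one, hw.sum_eq_one, Finset.sum_const, Finset.card_univ, card_inputPair,
      nsmul_eq_mul] at h
    rw [h, one_div_mul_cancel (choose_two_pos hn).ne']

/-- The input pairs with first or second component in given sets. -/
theorem card_pairs_le (X Y : Finset (Fin n)) :
    (∑ p : InputPair n, ind (p.1.1 ∈ X ∧ p.1.2 ∈ Y)) ≤ X.card * Y.card := by
  classical
  have h : ∑ p : InputPair n, ind (p.1.1 ∈ X ∧ p.1.2 ∈ Y) =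
      ((Finset.univ.filter fun p : InputPair n => p.1.1 ∈ X ∧ p.1.2 ∈ Y).card : ℝ) := by
    rw [Finset.card_filter]
    push_cast
    refine Finset.sum_congr rfl fun p _ => ?_
    unfold ind; split_ifs <;> rfl
  rw [h, ← Nat.cast_mul, ← Finset.card_product]
  refine Nat.cast_le.2 (Finset.card_le_card_of_injOn (fun p => p.1) ?_ ?_)
  · intro p hp
    simpa using hp
  · intro p _ q _ h
    exact Subtype.ext h

theorem sum_gateWeight_inputs_le (hw : IsDistribution w) (hn : 2 ≤ n) (X Y : Finset (Fin n)) :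
    ∑ g, gateWeight w n g * ind (g.1.1.1 ∈ X ∧ g.1.1.2 ∈ Y) ≤
      4 * X.card * Y.card / (n : ℝ) ^ 2 := by
  rw [sum_gateWeight_mul]
  simp only [← Finset.sum_mul, hw.sum_eq_one, one_mul]
  calc _ ≤ 4 / (n : ℝ) ^ 2 * (X.card * Y.card) :=
        mul_le_mul (one_div_choose_two_le hn) (card_pairs_le X Y)
          (Finset.sum_nonneg fun _ _ => ind_nonneg _) (by positivity)
    _ = _ := by ring

/-- A gate has an input in a given set only rarely. -/
theorem sum_gateWeight_hit_le (hw : IsDistribution w) (hn : 2 ≤ n) (X : Finset (Fin n)) :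
    ∑ g, gateWeight w n g * ind (g.1.1.1 ∈ X ∨ g.1.1.2 ∈ X) ≤ 8 * X.card / n := by
  have h1 := sum_gateWeight_inputs_le hw hn X Finset.univ
  have h2 := sum_gateWeight_inputs_le hw hn Finset.univ X
  have hn0 : (n : ℝ) ≠ 0 := by
    have : n ≠ 0 := by omega
    exact_mod_cast this
  simp only [Finset.mem_univ, and_true, true_and, Finset.card_univ, Fintype.card_fin] at h1 h2
  calc _ ≤ ∑ g, gateWeight w n g * ind (g.1.1.1 ∈ X) +
        ∑ g, gateWeight w n g * ind (g.1.1.2 ∈ X) := by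
        rw [← Finset.sum_add_distrib]
        refine Finset.sum_le_sum fun g _ => ?_
        rw [← mul_add]
        exact mul_le_mul_of_nonneg_left (ind_or_le _ _) ((isWeight_gateWeight hw hn).nonneg g)
    _ ≤ _ := add_le_add h1 h2
    _ = _ := by field_simp; ring

theorem pr_eq_expect (P : Automaton n → Prop) :
    pr w n P = expect (gateWeight w n) (fun ω => ind (P (toAut ω))) := by
  classical
  rw [pr, expect, ← (Equiv.arrowProdEquivProdArrow (Fin n) (fun _ => InputPair n)
    (fun _ => BoolFn)).symm.sum_comp, Fintype.sum_prod_type]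
  refine Finset.sum_congr rfl fun D _ => Finset.sum_congr rfl fun f _ => ?_
  change _ = (∏ i, gateWeight w n (D i, f i)) * ind (P ⟨D, f⟩)
  by_cases h : P ⟨D, f⟩ <;> simp [ind, h, gateWeight]

/-! ### The joint law of labels -/

/-- The in-trees of the listed gates, to the listed depths, avoid `S` and yield the listed
labels. -/
def TreeEvent (ω : Fin n → Gate n) (S : Finset (Fin n)) (L : List (Fin n × ℕ × Option Bool)) :
    Prop :=
  ∀ x ∈ L, Fresh ω S x.2.1 x.1 ∧ label ω ∅ x.2.1 x.1 = x.2.2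

/-- The probability of the listed labels when they are independent. -/
def lawProd (w : BoolFn → ℝ) (L : List (Fin n × ℕ × Option Bool)) : ℝ :=
  (L.map fun x => law w x.2.1 x.2.2).prod

theorem lawProd_mem (hw : IsDistribution w) (L : List (Fin n × ℕ × Option Bool)) :
    0 ≤ lawProd w L ∧ lawProd w L ≤ 1 := by
  induction L with
  | nil => simp [lawProd]
  | cons x L ih =>
    simp only [lawProd, List.map_cons, List.prod_cons] at ih ⊢
    exact ⟨mul_nonneg (law_nonneg hw _ _) ih.1,
      mul_le_one₀ (law_le_one hw _ _) ih.1 ih.2⟩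

/-- One exploration step: once gate `i` is revealed to be `g`, it is enough that everything else
avoids `i` as well, an event that does not read gate `i`. -/
theorem treeEvent_update {ω : Fin n → Gate n} {S : Finset (Fin n)} {i : Fin n} {t : ℕ}
    {v : Option Bool} {L : List (Fin n × ℕ × Option Bool)} {g : Gate n} (hi : i ∉ S)
    {y z : Option Bool} (hv : forcedVal g.2 y z = v)
    (h : TreeEvent ω (insert i S) ((g.1.1.1, t, y) :: (g.1.1.2, t, z) :: L)) :
    TreeEvent (Function.update ω i g) S ((i, t + 1, v) :: L) := by
  have hω : ∀ j ∉ insert i S, ω j = Function.update ω i g j := by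
    intro j hj
    rw [Function.update_of_ne]
    rintro rfl
    exact hj (Finset.mem_insert_self _ _)
  have key : ∀ s j u, Fresh ω (insert i S) s j ∧ label ω ∅ s j = u →
      Fresh (Function.update ω i g) S s j ∧ label (Function.update ω i g) ∅ s j = u := by
    rintro s j u ⟨h1, h2⟩
    exact ⟨(h1.congr hω).mono (Finset.subset_insert _ _), by rw [← h1.label_empty_congr hω, h2]⟩
  intro x hx
  rcases List.mem_cons.1 hx with rfl | hx
  · obtain ⟨f1, l1⟩ := key _ _ _ (h _ (by simp : (g.1.1.1, t, y) ∈ _))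
    obtain ⟨f2, l2⟩ := key _ _ _ (h _ (by simp : (g.1.1.2, t, z) ∈ _))
    constructor
    · refine ⟨hi, ?_⟩
      simp only [Function.update_self]
      exact ⟨f1, f2⟩
    · simp only [label, Finset.notMem_empty, if_false, Function.update_self]
      rw [← hv]
      exact congrArg₂ _ l1 l2
  · exact key _ _ _ (h x (by simp [hx]))

/-- For given `ω` only the actual pair of input labels contributes to the sum. -/
theorem sum_ind_treeEvent_le {ω : Fin n → Gate n} {S : Finset (Fin n)} {i : Fin n} {t : ℕ}
    {v : Option Bool} {L : List (Fin n × ℕ × Option Bool)} {g : Gate n} (hi : i ∉ S) :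
    (∑ y, ∑ z, if forcedVal g.2 y z = v then
      ind (TreeEvent ω (insert i S) ((g.1.1.1, t, y) :: (g.1.1.2, t, z) :: L)) else 0) ≤
      ind (TreeEvent (Function.update ω i g) S ((i, t + 1, v) :: L)) := by
  set R := ind (TreeEvent (Function.update ω i g) S ((i, t + 1, v) :: L))
  have hR : 0 ≤ R := ind_nonneg _
  calc _ ≤ ∑ y, ∑ z, (if y = label ω ∅ t g.1.1.1 then
        (if z = label ω ∅ t g.1.1.2 then R else 0) else 0) := by
        refine Finset.sum_le_sum fun y _ => Finset.sum_le_sum fun z _ => ?_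
        by_cases h : forcedVal g.2 y z = v ∧
          TreeEvent ω (insert i S) ((g.1.1.1, t, y) :: (g.1.1.2, t, z) :: L)
        · rw [if_pos h.1, if_pos (h.2 _ (by simp : (g.1.1.1, t, y) ∈ _)).2.symm,
            if_pos (h.2 _ (by simp : (g.1.1.2, t, z) ∈ _)).2.symm]
          exact ind_mono (treeEvent_update hi h.1)
        · have : (if forcedVal g.2 y z = v then
              ind (TreeEvent ω (insert i S) ((g.1.1.1, t, y) :: (g.1.1.2, t, z) :: L)) else 0)
              = 0 := by
            split_ifs with h'
            · exact ind_of_false fun h'' => h ⟨h', h''⟩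
            · rfl
          rw [this]
          split_ifs <;> simp [hR]
    _ = R := by
        rw [Finset.sum_eq_single (label ω ∅ t g.1.1.1) _ (by simp)]
        · simp
        · intro y _ hy; simp [hy]

/-- The labels of distinct gates are asymptotically independent with the limit law. -/
theorem exists_lawProd_sub_le (hw : IsDistribution w) (T : List ℕ) (s : ℕ) :
    ∃ C : ℝ, 0 ≤ C ∧ ∀ n : ℕ, 2 ≤ n → ∀ S : Finset (Fin n), S.card ≤ s →
      ∀ L : List (Fin n × ℕ × Option Bool), L.map (fun x => x.2.1) = T →
      (L.map fun x => x.1).Nodup → (∀ x ∈ L, x.1 ∉ S) →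
      lawProd w L - C / n ≤ expect (gateWeight w n) fun ω => ind (TreeEvent ω S L) := by
  match T with
  | [] =>
    refine ⟨0, le_rfl, fun n hn S _ L hL _ _ => ?_⟩
    obtain rfl : L = [] := by simpa using hL
    have : ∀ ω : Fin n → Gate n, ind (TreeEvent ω S []) = 1 := fun ω =>
      ind_of_true (by simp [TreeEvent])
    simp only [this, expect_const (isWeight_gateWeight hw hn)]
    simp [lawProd]
  | 0 :: T =>
    obtain ⟨C, hC, ih⟩ := exists_lawProd_sub_le hw T s
    refine ⟨C, hC, fun n hn S hS L hL hnd hLS => ?_⟩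
    rcases L with _ | ⟨⟨i, t, v⟩, L⟩
    · simp at hL
    obtain ⟨rfl, hLT⟩ : t = 0 ∧ L.map (fun x => x.2.1) = T := by simpa using hL
    have ih' := ih n hn S hS L hLT (List.nodup_cons.1 hnd).2 fun x hx => hLS x (by simp [hx])
    by_cases hv : v = none
    · have h1 : ∀ ω : Fin n → Gate n,
          ind (TreeEvent ω S ((i, 0, v) :: L)) = ind (TreeEvent ω S L) := by
        intro ω
        refine ind_congr ⟨fun h x hx => h x (by simp [hx]), fun h x hx => ?_⟩
        rcases List.mem_cons.1 hx with rfl | hx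
        · exact ⟨hLS _ (by simp), hv.symm⟩
        · exact h x hx
      simp only [h1]
      simpa [lawProd, law, hv] using ih'
    · have h1 : lawProd w ((i, 0, v) :: L) = 0 := by simp [lawProd, law, hv]
      rw [h1]
      have : 0 ≤ C / n := by positivity
      exact le_trans (by linarith) (expect_nonneg (isWeight_gateWeight hw hn)
        fun ω => ind_nonneg _)
  | (t + 1) :: T =>
    -- Revealing the first gate replaces it by its two inputs at depth `t` and adds it to the
    -- forbidden set.
    obtain ⟨C, hC, ih⟩ := exists_lawProd_sub_le hw (t :: t :: T) (s + 1)
    -- The first term pays for an input that hits a known gate, the second for the error `C / n` in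
    -- each of the `9` pairs of input labels.
    refine ⟨8 * (s + 1 + T.length) + 9 * C, by positivity, fun n hn S hS L hL hnd hLS => ?_⟩
    rcases L with _ | ⟨⟨i, t', v⟩, L⟩
    · simp at hL
    obtain ⟨rfl, hLT⟩ : t' = t + 1 ∧ L.map (fun x => x.2.1) = T := by simpa using hL
    have hρ := isWeight_gateWeight hw hn
    have hi : i ∉ S := hLS (i, t + 1, v) (by simp)
    obtain ⟨hiL, hnd'⟩ := List.nodup_cons.1 hnd
    set X : Finset (Fin n) := insert i S ∪ (L.map fun x => x.1).toFinset with hX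
    have hXcard : (X.card : ℝ) ≤ s + 1 + T.length := by
      have h1 : X.card ≤ (insert i S).card + (L.map fun x => x.1).toFinset.card :=
        Finset.card_union_le _ _
      have h2 : (insert i S).card ≤ S.card + 1 := Finset.card_insert_le _ _
      have h3 : (L.map fun x => x.1).toFinset.card ≤ T.length := by
        refine (List.toFinset_card_le _).trans ?_
        rw [← hLT]; simp
      exact_mod_cast (show X.card ≤ s + 1 + T.length by omega)
    set hit : Gate n → Prop := fun g => g.1.1.1 ∈ X ∨ g.1.1.2 ∈ X
    set A : BoolFn → ℝ := fun f => ∑ y, ∑ z,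
      if forcedVal f y z = v then law w t y * law w t z else 0 with hA
    have hA1 : ∀ f, A f ≤ 1 := by
      intro f
      have : A f ≤ ∑ y, ∑ z, law w t y * law w t z := by
        refine Finset.sum_le_sum fun y _ => Finset.sum_le_sum fun z _ => ?_
        split_ifs
        · exact le_rfl
        · exact mul_nonneg (law_nonneg hw _ _) (law_nonneg hw _ _)
      refine this.trans (le_of_eq ?_)
      simp only [← Finset.mul_sum, sum_law hw, mul_one]
    obtain ⟨hP0, hP1⟩ := lawProd_mem hw L
    have hgate : ∀ g : Gate n, A g.2 * lawProd w L - ind (hit g) - 9 * C / n ≤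
        expect (gateWeight w n) fun ω =>
          ind (TreeEvent (Function.update ω i g) S ((i, t + 1, v) :: L)) := by
      intro g
      have hCn : 0 ≤ C / n := by positivity
      have hnn : 0 ≤ expect (gateWeight w n) fun ω =>
          ind (TreeEvent (Function.update ω i g) S ((i, t + 1, v) :: L)) :=
        expect_nonneg hρ fun ω => ind_nonneg _
      by_cases hg : hit g
      · rw [ind_of_true hg]
        have : A g.2 * lawProd w L ≤ 1 := mul_le_one₀ (hA1 _) hP0 hP1
        have : 9 * C / n = 9 * (C / n) := by ring
        linarith
      · rw [ind_of_false hg]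
        have hg' : g.1.1.1 ∉ X ∧ g.1.1.2 ∉ X := not_or.1 hg
        have h1 : ∀ y z, law w t y * law w t z * lawProd w L - C / n ≤
            expect (gateWeight w n) fun ω =>
              ind (TreeEvent ω (insert i S) ((g.1.1.1, t, y) :: (g.1.1.2, t, z) :: L)) := by
          intro y z
          have := ih n hn (insert i S) ((Finset.card_insert_le _ _).trans (by omega))
            ((g.1.1.1, t, y) :: (g.1.1.2, t, z) :: L) (by simp [hLT]) (by
              have := g.1.2.ne
              simp only [hX, Finset.mem_union, List.mem_toFinset, not_or] at hg'
              simp only [List.map_cons, List.nodup_cons, List.mem_cons, not_or]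
              exact ⟨⟨this, hg'.1.2⟩, hg'.2.2, hnd'⟩) (by
              intro x hx
              simp only [hX, Finset.mem_union, not_or] at hg'
              rcases List.mem_cons.1 hx with rfl | hx
              · exact hg'.1.1
              rcases List.mem_cons.1 hx with rfl | hx
              · exact hg'.2.1
              · rw [Finset.mem_insert, not_or]
                refine ⟨fun h => hiL ?_, hLS x (by simp [hx])⟩
                exact List.mem_map.2 ⟨x, hx, h⟩)
          simpa [lawProd, mul_assoc] using this
        have h2 : A g.2 * lawProd w L - 9 * C / n ≤
            ∑ y : Option Bool, ∑ z : Option Bool, if forcedVal g.2 y z = v then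
              expect (gateWeight w n) fun ω =>
                ind (TreeEvent ω (insert i S) ((g.1.1.1, t, y) :: (g.1.1.2, t, z) :: L))
            else 0 := by
          have h9 : 9 * C / n = ∑ y : Option Bool, ∑ z : Option Bool, C / n := by
            simp [Finset.sum_const, Finset.card_univ]; ring
          rw [h9, hA, Finset.sum_mul, ← Finset.sum_sub_distrib]
          refine Finset.sum_le_sum fun y _ => ?_
          rw [Finset.sum_mul, ← Finset.sum_sub_distrib]
          refine Finset.sum_le_sum fun z _ => ?_
          split_ifs
          · exact h1 y z
          · linarith
        rw [sub_zero]
        refine h2.trans ?_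
        calc _ = expect (gateWeight w n) fun ω => ∑ y, ∑ z, if forcedVal g.2 y z = v then
                ind (TreeEvent ω (insert i S) ((g.1.1.1, t, y) :: (g.1.1.2, t, z) :: L))
              else 0 := by
              rw [expect_sum]
              refine Finset.sum_congr rfl fun y _ => ?_
              rw [expect_sum]
              refine Finset.sum_congr rfl fun z _ => ?_
              split_ifs
              · rfl
              · rw [expect_const hρ]
          _ ≤ _ := expect_mono hρ fun ω => sum_ind_treeEvent_le hi
    rw [expect_resample hρ i, expect_sum]
    simp only [expect_const_mul]
    calc lawProd w ((i, t + 1, v) :: L) - (8 * (s + 1 + T.length) + 9 * C) / n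
        ≤ law w (t + 1) v * lawProd w L - 8 * X.card / n - 9 * C / n := by
          have : 8 * (X.card : ℝ) / n ≤ 8 * (s + 1 + T.length) / n := by gcongr
          simp only [lawProd, List.map_cons, List.prod_cons, add_div]
          linarith
      _ ≤ law w (t + 1) v * lawProd w L - (∑ g, gateWeight w n g * ind (hit g)) - 9 * C / n := by
          have := sum_gateWeight_hit_le hw hn X
          linarith
      _ = ∑ g, gateWeight w n g * (A g.2 * lawProd w L - ind (hit g) - 9 * C / n) := by
          simp only [mul_sub, Finset.sum_sub_distrib, ← Finset.sum_mul, hρ.sum_eq_one, one_mul]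
          congr 2
          have := sum_gateWeight_mul (w := w) (fun g : Gate n => A g.2 * lawProd w L)
          rw [this]
          simp only [Finset.sum_const, Finset.card_univ, card_inputPair, nsmul_eq_mul]
          rw [← mul_assoc, one_div_mul_cancel (choose_two_pos hn).ne', one_mul]
          simp only [law, ← mul_assoc, Finset.sum_mul]
          rfl
      _ ≤ _ := Finset.sum_le_sum fun g _ =>
          mul_le_mul_of_nonneg_left (hgate g) (hρ.nonneg g)
  -- Two trees of depth `t` weigh `2 * 3 ^ t < 3 ^ (t + 1)`.
  termination_by (T.map (fun t => 3 ^ t)).sum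
  decreasing_by
    · simp
    · have : 0 < 3 ^ t := by positivity
      simp [pow_succ]
      omega

end JointLaw

section Concentration

variable {w : BoolFn → ℝ} {n : ℕ}

/-! ### Concentration of the mean number of effective inputs -/

/-- Turns lower bounds on all atoms into two-sided bounds: as total masses agree, no atom can gain
more than the others lose. -/
theorem abs_le_of_sum_eq_zero {κ : Type*} [Fintype κ] [DecidableEq κ] {d : κ → ℝ} {c : ℝ}
    (hd : ∀ x, -c ≤ d x) (h0 : ∑ x, d x = 0) (hc : 0 ≤ c) (x : κ) :
    |d x| ≤ Fintype.card κ * c := by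
  have h1 : ((Finset.univ.erase x).card : ℝ) * (-c) ≤ ∑ y ∈ Finset.univ.erase x, d y := by
    rw [← nsmul_eq_mul]
    exact Finset.card_nsmul_le_sum _ _ _ fun y _ => hd y
  have h2 := Finset.add_sum_erase Finset.univ d (Finset.mem_univ x)
  have h3 : ((Finset.univ.erase x).card : ℝ) + 1 = Fintype.card κ := by
    rw [← Finset.card_univ]
    exact_mod_cast Finset.card_erase_add_one (Finset.mem_univ x)
  have h4 : (0 : ℝ) ≤ (Finset.univ.erase x).card := Nat.cast_nonneg _
  rw [← h3, abs_le]
  constructor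
  · nlinarith [hd x]
  · nlinarith

theorem expect_label_pair (hw : IsDistribution w) (t : ℕ) :
    ∃ C : ℝ, 0 ≤ C ∧ ∀ n : ℕ, 2 ≤ n → ∀ i i' : Fin n, i ≠ i' → ∀ x : Option Bool × Option Bool,
      |expect (gateWeight w n) (fun ω => ind (label ω ∅ t i = x.1 ∧ label ω ∅ t i' = x.2)) -
        law w t x.1 * law w t x.2| ≤ C / n := by
  obtain ⟨C, hC, h⟩ := exists_lawProd_sub_le hw [t, t] 0
  refine ⟨9 * C, by positivity, fun n hn i i' hii' => ?_⟩
  have hρ := isWeight_gateWeight hw hn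
  have hsum : ∑ x : Option Bool × Option Bool,
      (expect (gateWeight w n) (fun ω => ind (label ω ∅ t i = x.1 ∧ label ω ∅ t i' = x.2)) -
        law w t x.1 * law w t x.2) = 0 := by
    rw [Finset.sum_sub_distrib, ← expect_sum]
    have h1 : ∀ ω : Fin n → Gate n, ∑ x : Option Bool × Option Bool,
        ind (label ω ∅ t i = x.1 ∧ label ω ∅ t i' = x.2) = 1 := by
      intro ω
      rw [Finset.sum_eq_single (label ω ∅ t i, label ω ∅ t i') _ (by simp)]
      · exact ind_of_true ⟨rfl, rfl⟩
      · rintro ⟨v, v'⟩ _ hne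
        refine ind_of_false fun h => hne ?_
        rw [h.1, h.2]
    simp only [h1, expect_const hρ]
    rw [Fintype.sum_prod_type]
    simp only [← Finset.mul_sum, sum_law hw, mul_one, sub_self]
  have hlow : ∀ x : Option Bool × Option Bool, -(C / n) ≤
      expect (gateWeight w n) (fun ω => ind (label ω ∅ t i = x.1 ∧ label ω ∅ t i' = x.2)) -
        law w t x.1 * law w t x.2 := by
    intro x
    have h1 := h n hn ∅ (by simp) [(i, t, x.1), (i', t, x.2)] (by simp) (by simp [hii'])
      (by simp)
    have h2 : expect (gateWeight w n) (fun ω => ind (TreeEvent ω ∅ [(i, t, x.1), (i', t, x.2)])) ≤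
        expect (gateWeight w n) (fun ω => ind (label ω ∅ t i = x.1 ∧ label ω ∅ t i' = x.2)) :=
      expect_mono hρ fun ω => ind_mono fun hω =>
        ⟨(hω (i, t, x.1) (by simp)).2, (hω (i', t, x.2) (by simp)).2⟩
    simp only [lawProd, List.map_cons, List.map_nil, List.prod_cons, List.prod_nil, mul_one] at h1
    linarith
  intro x
  refine (abs_le_of_sum_eq_zero hlow hsum (by positivity) x).trans (le_of_eq ?_)
  simp only [Fintype.card_prod, Fintype.card_option, Fintype.card_bool]
  push_cast
  ring

/-- The second moment of a centred sum of functions of the labels. -/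
theorem expect_sq_sum_le (hw : IsDistribution w) (t : ℕ) :
    ∃ C : ℝ, 0 ≤ C ∧ ∀ n : ℕ, 2 ≤ n → ∀ (h : Fin n → Option Bool → ℝ) (B : ℝ),
      (∀ u v, |h u v| ≤ B) →
      expect (gateWeight w n) (fun ω =>
        (∑ u, (h u (label ω ∅ t u) - ∑ v, law w t v * h u v)) ^ 2) ≤ C * B ^ 2 * n := by
  obtain ⟨C, hC, hpair⟩ := expect_label_pair hw t
  -- Centred terms are at most `2 * B`, so each of `n` diagonal terms costs `4 * B ^ 2`. Each
  -- off-diagonal term costs `9 * (4 * B ^ 2) * (C / n)`.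
  refine ⟨4 + 36 * C, by positivity, fun n hn h B hB => ?_⟩
  have hρ := isWeight_gateWeight hw hn
  have hn0 : (0 : ℝ) < n := by
    have : 0 < n := by omega
    exact_mod_cast this
  set k : Fin n → Option Bool → ℝ := fun u v => h u v - ∑ v, law w t v * h u v with hk
  have hmean : ∀ u, |∑ v, law w t v * h u v| ≤ B := by
    intro u
    refine (Finset.abs_sum_le_sum_abs _ _).trans ?_
    calc _ ≤ ∑ v, law w t v * B := by
          refine Finset.sum_le_sum fun v _ => ?_
          rw [abs_mul, abs_of_nonneg (law_nonneg hw t v)]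
          exact mul_le_mul_of_nonneg_left (hB u v) (law_nonneg hw t v)
      _ = B := by rw [← Finset.sum_mul, sum_law hw, one_mul]
  have hkB : ∀ u v, |k u v| ≤ 2 * B := by
    intro u v
    refine (abs_sub _ _).trans ?_
    linarith [hB u v, hmean u]
  have hk0 : ∀ u, ∑ v, law w t v * k u v = 0 := by
    intro u
    simp only [hk, mul_sub, Finset.sum_sub_distrib, ← Finset.sum_mul, sum_law hw, one_mul,
      sub_self]
  have hkk : ∀ u u' v v', k u v * k u' v' ≤ 4 * B ^ 2 ∧ |k u v * k u' v'| ≤ 4 * B ^ 2 := by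
    intro u u' v v'
    have : |k u v * k u' v'| ≤ 4 * B ^ 2 := by
      rw [abs_mul]
      calc _ ≤ (2 * B) * (2 * B) := mul_le_mul (hkB _ _) (hkB _ _) (abs_nonneg _)
            ((abs_nonneg _).trans (hkB u v))
        _ = _ := by ring
    exact ⟨(le_abs_self _).trans this, this⟩
  have hoff : ∀ u u', u ≠ u' → expect (gateWeight w n)
      (fun ω => k u (label ω ∅ t u) * k u' (label ω ∅ t u')) ≤ 36 * C * B ^ 2 / n := by
    intro u u' huu'
    have h1 : ∀ ω : Fin n → Gate n, k u (label ω ∅ t u) * k u' (label ω ∅ t u') =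
        ∑ x : Option Bool × Option Bool,
          k u x.1 * k u' x.2 * ind (label ω ∅ t u = x.1 ∧ label ω ∅ t u' = x.2) := by
      intro ω
      rw [Finset.sum_eq_single (label ω ∅ t u, label ω ∅ t u') _ (by simp)]
      · rw [ind_of_true ⟨rfl, rfl⟩, mul_one]
      · rintro ⟨v, v'⟩ _ hne
        rw [ind_of_false, mul_zero]
        intro h
        apply hne
        rw [h.1, h.2]
    simp only [h1]
    rw [expect_sum]
    simp only [expect_const_mul]
    -- Under the product law centred functions are uncorrelated, so only the error in the joint law
    -- remains.
    have h2 : ∑ x : Option Bool × Option Bool,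
        k u x.1 * k u' x.2 * (law w t x.1 * law w t x.2) = 0 := by
      rw [Fintype.sum_prod_type]
      calc _ = ∑ v, ∑ v', (law w t v * k u v) * (law w t v' * k u' v') :=
            Finset.sum_congr rfl fun v _ => Finset.sum_congr rfl fun v' _ => by ring
        _ = 0 := by simp only [← Finset.mul_sum, hk0, mul_zero, Finset.sum_const_zero]
    rw [← sub_zero (∑ x : Option Bool × Option Bool, _), ← h2, ← Finset.sum_sub_distrib]
    calc _ ≤ ∑ x : Option Bool × Option Bool, 4 * B ^ 2 * (C / n) := by
          refine Finset.sum_le_sum fun x _ => ?_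
          rw [← mul_sub]
          refine (le_abs_self _).trans ?_
          rw [abs_mul]
          exact mul_le_mul (hkk _ _ _ _).2 (hpair n hn u u' huu' x) (abs_nonneg _)
            (by positivity)
      _ = _ := by
          simp only [Finset.sum_const, Finset.card_univ, Fintype.card_prod, Fintype.card_option,
            Fintype.card_bool, nsmul_eq_mul]
          push_cast; ring
  have hon : ∀ u, expect (gateWeight w n)
      (fun ω => k u (label ω ∅ t u) * k u (label ω ∅ t u)) ≤ 4 * B ^ 2 := fun u =>
    (expect_mono hρ fun ω => (hkk u u _ _).1).trans (expect_const hρ _).le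
  calc _ = ∑ u, ∑ u', expect (gateWeight w n)
        (fun ω => k u (label ω ∅ t u) * k u' (label ω ∅ t u')) := by
        simp only [pow_two, Finset.sum_mul_sum]
        rw [expect_sum]
        exact Finset.sum_congr rfl fun u _ => expect_sum _ _
    _ ≤ ∑ u : Fin n, ∑ u' : Fin n, ((if u = u' then 4 * B ^ 2 else 0) + 36 * C * B ^ 2 / n) := by
        refine Finset.sum_le_sum fun u _ => Finset.sum_le_sum fun u' _ => ?_
        have : 0 ≤ 36 * C * B ^ 2 / n := by positivity
        split_ifs with huu'
        · subst huu'
          linarith [hon u]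
        · linarith [hoff u u' huu']
    _ = _ := by
        simp only [Finset.sum_add_distrib, Finset.sum_ite_eq, Finset.mem_univ, if_true,
          Finset.sum_const, Finset.card_univ, Fintype.card_fin, nsmul_eq_mul]
        field_simp

/-- The probability that a random gate has `j` as an effective input. -/
def edgeProb (w : BoolFn → ℝ) (τ : Fin n → Option Bool) (j : Fin n) : ℝ :=
  ∑ g, gateWeight w n g * ind (EffEdge g τ j)

/-- The mean number of effective inputs of a random gate. -/
def meanEff (w : BoolFn → ℝ) (τ : Fin n → Option Bool) : ℝ := ∑ j, edgeProb w τ j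

theorem sum_ind_eq_and {κ : Type*} [Fintype κ] (a : κ) (P : Prop) :
    ∑ j, ind (a = j ∧ P) = ind P := by
  classical
  rw [Finset.sum_eq_single a _ (by simp)]
  · exact ind_congr (by simp)
  · intro b _ hb
    exact ind_of_false fun h => hb h.1.symm

theorem sum_ind_effEdge (g : Gate n) (τ : Fin n → Option Bool) :
    ∑ j, ind (EffEdge g τ j) = ind (EffFst g.2 (τ g.1.1.2)) + ind (EffSnd g.2 (τ g.1.1.1)) := by
  rw [← sum_ind_eq_and g.1.1.1, ← sum_ind_eq_and g.1.1.2 (EffSnd _ _), ← Finset.sum_add_distrib]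
  refine Finset.sum_congr rfl fun j _ => ?_
  by_cases h1 : g.1.1.1 = j
  · have h2 : g.1.1.2 ≠ j := fun h => g.1.2.ne (h1.trans h.symm)
    simp [EffEdge, h1, h2, ind_of_false]
  · simp [EffEdge, h1, ind_of_false]

/-- The contribution of a gate with label `v` to the mean number of effective inputs. -/
def labelWeight (w : BoolFn → ℝ) (u : Fin n) (v : Option Bool) : ℝ :=
  1 / (n.choose 2 : ℝ) * ∑ p : InputPair n,
    (ind (p.1.2 = u) * effProbFst w v + ind (p.1.1 = u) * effProbSnd w v)

/-- Whether an input is effective depends on the label of the other input only, so the mean is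
additive over labels and the second moment bound applies. -/
theorem meanEff_eq (τ : Fin n → Option Bool) : meanEff w τ = ∑ u, labelWeight w u (τ u) := by
  have h1 : meanEff w τ = 1 / (n.choose 2 : ℝ) * ∑ p : InputPair n,
      (effProbFst w (τ p.1.2) + effProbSnd w (τ p.1.1)) := by
    simp only [meanEff, edgeProb]
    rw [Finset.sum_comm]
    simp only [← Finset.mul_sum, sum_ind_effEdge]
    rw [sum_gateWeight_mul]
    congr 1
    refine Finset.sum_congr rfl fun p _ => ?_
    simp only [mul_add, Finset.sum_add_distrib]
    rfl
  rw [h1]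
  simp only [labelWeight]
  rw [← Finset.mul_sum, Finset.sum_comm]
  congr 1
  refine Finset.sum_congr rfl fun p _ => ?_
  rw [Finset.sum_add_distrib, Finset.sum_eq_single p.1.2 _ (by simp),
    Finset.sum_eq_single p.1.1 _ (by simp)]
  · simp [ind_of_true]
  · intro b _ hb; rw [ind_of_false (Ne.symm hb), zero_mul]
  · intro b _ hb; rw [ind_of_false (Ne.symm hb), zero_mul]

theorem abs_labelWeight_le (hw : IsDistribution w) (hn : 2 ≤ n) (u : Fin n) (v : Option Bool) :
    |labelWeight w u v| ≤ 8 / n := by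
  have hf := sum_mul_ind_mem hw fun f => EffFst f v
  have hs := sum_mul_ind_mem hw fun f => EffSnd f v
  change 0 ≤ effProbFst w v ∧ effProbFst w v ≤ 1 at hf
  change 0 ≤ effProbSnd w v ∧ effProbSnd w v ≤ 1 at hs
  have hn0 : (n : ℝ) ≠ 0 := by
    have : n ≠ 0 := by omega
    exact_mod_cast this
  have h0 : 0 ≤ ∑ p : InputPair n,
      (ind (p.1.2 = u) * effProbFst w v + ind (p.1.1 = u) * effProbSnd w v) :=
    Finset.sum_nonneg fun p _ => add_nonneg (mul_nonneg (ind_nonneg _) hf.1)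
      (mul_nonneg (ind_nonneg _) hs.1)
  rw [labelWeight, abs_of_nonneg (mul_nonneg (by positivity) h0)]
  have h1 := card_pairs_le (Finset.univ : Finset (Fin n)) {u}
  have h2 := card_pairs_le {u} (Finset.univ : Finset (Fin n))
  simp only [Finset.mem_univ, true_and, and_true, Finset.mem_singleton, Finset.card_univ,
    Fintype.card_fin, Finset.card_singleton, Nat.cast_one, mul_one, one_mul] at h1 h2
  calc _ ≤ 4 / (n : ℝ) ^ 2 * (n + n) := by
        refine mul_le_mul (one_div_choose_two_le hn) ?_ h0 (by positivity)
        refine le_trans ?_ (add_le_add h1 h2)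
        rw [← Finset.sum_add_distrib]
        exact Finset.sum_le_sum fun p _ => add_le_add
          (mul_le_of_le_one_right (ind_nonneg _) hf.2)
          (mul_le_of_le_one_right (ind_nonneg _) hs.2)
    _ = 8 / n := by field_simp; ring

theorem sum_law_labelWeight (hn : 2 ≤ n) (t : ℕ) :
    ∑ u : Fin n, ∑ v, law w t v * labelWeight w u v =
      ∑ v, law w t v * effProbFst w v + ∑ v, law w t v * effProbSnd w v := by
  have h : ∀ v, ∑ u : Fin n, labelWeight w u v = effProbFst w v + effProbSnd w v := by
    intro v
    -- The sum over gates is the mean number of effective inputs when every label equals `v`.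
    rw [← meanEff_eq (fun _ : Fin n => v)]
    simp only [meanEff, edgeProb]
    rw [Finset.sum_comm]
    simp only [← Finset.mul_sum, sum_ind_effEdge]
    rw [sum_gateWeight_mul]
    simp only [mul_add, Finset.sum_add_distrib, Finset.sum_const, Finset.card_univ,
      card_inputPair, nsmul_eq_mul]
    rw [← mul_assoc, ← mul_assoc, one_div_mul_cancel (choose_two_pos hn).ne', one_mul, one_mul]
    rfl
  rw [Finset.sum_comm]
  simp only [← Finset.mul_sum, h, mul_add, Finset.sum_add_distrib]

/-- The mean number of effective inputs is unlikely to exceed its limit. -/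
theorem expect_meanEff_large_le (hw : IsDistribution w) (hsymm : IsSymmetric w) (t : ℕ) {δ : ℝ}
    (hδ : 0 < δ) : ∃ C : ℝ, ∀ n : ℕ, 2 ≤ n → expect (gateWeight w n) (fun ω =>
      ind (1 - probA w + probC w + 2 * unforced w t + δ ≤ meanEff w (label ω ∅ t))) ≤ C / n := by
  obtain ⟨C, hC, h⟩ := expect_sq_sum_le hw t
  refine ⟨C * 64 / δ ^ 2, fun n hn => ?_⟩
  have hρ := isWeight_gateWeight hw hn
  have hn0 : (n : ℝ) ≠ 0 := by
    have : n ≠ 0 := by omega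
    exact_mod_cast this
  have h1 := h n hn (labelWeight w) (8 / n) (abs_labelWeight_le hw hn)
  have h2 := expect_ind_le_div hρ (F := fun ω => (∑ u, (labelWeight w u (label ω ∅ t u) -
    ∑ v, law w t v * labelWeight w u v)) ^ 2) (fun ω => sq_nonneg _) (pow_pos hδ 2)
  calc _ ≤ _ := expect_mono hρ fun ω => ind_mono fun hω => ?_
    _ ≤ _ := h2
    _ ≤ (C * (8 / n) ^ 2 * n) / δ ^ 2 := by gcongr
    _ = _ := by field_simp; norm_num
  rw [Finset.sum_sub_distrib, ← meanEff_eq, sum_law_labelWeight hn]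
  have := sum_law_effProb_le hw hsymm t
  exact pow_le_pow_left₀ hδ.le (by linarith) 2

end Concentration

section Walks

variable {w : BoolFn → ℝ} {n : ℕ}

/-! ### Outdegrees and the gates that are influenced by a small set -/

open Classical in
/-- The gates that have `j` as an input. -/
def outGates (ω : Fin n → Gate n) (j : Fin n) : Finset (Fin n) :=
  Finset.univ.filter fun i => (ω i).1.1.1 = j ∨ (ω i).1.1.2 = j

theorem two_pow_card_outGates (ω : Fin n → Gate n) (j : Fin n) :
    (2 : ℝ) ^ (outGates ω j).card =
      ∏ i, (1 + ind ((ω i).1.1.1 ∈ ({j} : Finset (Fin n)) ∨ (ω i).1.1.2 ∈ ({j} : Finset _))) := by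
  classical
  rw [← Finset.prod_const, outGates, Finset.prod_filter]
  refine Finset.prod_congr rfl fun i _ => ?_
  simp only [Finset.mem_singleton, ind]
  split_ifs <;> norm_num

/-- A large outdegree is exponentially unlikely. -/
theorem expect_outGates_large_le (hw : IsDistribution w) (hn : 2 ≤ n) (Δ : ℕ) :
    expect (gateWeight w n) (fun ω => ind (∃ j, Δ ≤ (outGates ω j).card)) ≤
      n * (Real.exp 8 / 2 ^ Δ) := by
  have hρ := isWeight_gateWeight hw hn
  have hn0 : (n : ℝ) ≠ 0 := by
    have : n ≠ 0 := by omega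
    exact_mod_cast this
  have hj : ∀ j : Fin n, expect (gateWeight w n) (fun ω => ind (Δ ≤ (outGates ω j).card)) ≤
      Real.exp 8 / 2 ^ Δ := by
    intro j
    -- Markov for `2 ^ outdegree`, whose mean factorises over gates and is at most `(1 + 8 / n) ^ n
    -- ≤ exp 8`.
    calc _ ≤ expect (gateWeight w n)
          (fun ω => ind ((2 : ℝ) ^ Δ ≤ (2 : ℝ) ^ (outGates ω j).card)) :=
          expect_mono hρ fun ω => ind_mono fun h => pow_le_pow_right₀ one_le_two h
      _ ≤ _ := expect_ind_le_div hρ (fun ω => by positivity) (by positivity)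
      _ ≤ _ := by
          gcongr
          simp only [two_pow_card_outGates]
          rw [expect_prod (fun (_ : Fin n) (g : Gate n) =>
            1 + ind (g.1.1.1 ∈ ({j} : Finset (Fin n)) ∨ g.1.1.2 ∈ ({j} : Finset _)))]
          simp only [mul_add, mul_one, Finset.sum_add_distrib, hρ.sum_eq_one,
            Finset.prod_const, Finset.card_univ, Fintype.card_fin]
          have h1 := sum_gateWeight_hit_le hw hn {j}
          rw [Finset.card_singleton, Nat.cast_one, mul_one] at h1
          have h0 : 0 ≤ ∑ g, gateWeight w n g *
              ind (g.1.1.1 ∈ ({j} : Finset (Fin n)) ∨ g.1.1.2 ∈ ({j} : Finset _)) :=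
            Finset.sum_nonneg fun g _ => mul_nonneg (hρ.nonneg g) (ind_nonneg _)
          calc _ ≤ (Real.exp (8 / n)) ^ n := by
                refine pow_le_pow_left₀ (by linarith) ?_ n
                linarith [Real.add_one_le_exp (8 / (n : ℝ))]
            _ = Real.exp 8 := by
                rw [← Real.exp_nat_mul]
                congr 1
                field_simp
  calc _ ≤ expect (gateWeight w n) (fun ω => ∑ j, ind (Δ ≤ (outGates ω j).card)) :=
        expect_mono hρ fun ω => ind_exists_le _
    _ = ∑ j, expect (gateWeight w n) (fun ω => ind (Δ ≤ (outGates ω j).card)) :=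
        expect_sum _ _
    _ ≤ ∑ _j : Fin n, Real.exp 8 / 2 ^ Δ := Finset.sum_le_sum fun j _ => hj j
    _ = _ := by simp

open Classical in
/-- The gates whose in-neighbourhood of depth `t` meets `S`. -/
def stale (ω : Fin n → Gate n) (S : Finset (Fin n)) (t : ℕ) : Finset (Fin n) :=
  Finset.univ.filter fun i => ¬ Fresh ω S t i

/-- A gate stale at depth `t + 1` is in `S` or has an input stale at depth `t`, so each level
multiplies the bound by at most `1 + Δ`. -/
theorem card_stale_le {ω : Fin n → Gate n} {Δ : ℕ} (hΔ : ∀ j, (outGates ω j).card ≤ Δ)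
    (S : Finset (Fin n)) (t : ℕ) : (stale ω S t).card ≤ (1 + Δ) ^ t * S.card := by
  classical
  induction t with
  | zero =>
    simp only [pow_zero, one_mul]
    exact Finset.card_le_card fun i hi => by simpa [stale, Fresh] using hi
  | succ t ih =>
    have hsub : stale ω S (t + 1) ⊆ S ∪ (stale ω S t).biUnion (outGates ω) := by
      intro i hi
      simp only [stale, Finset.mem_filter, Finset.mem_univ, true_and, Fresh, not_and_or,
        not_not] at hi
      rw [Finset.mem_union, Finset.mem_biUnion]
      rcases hi with hi | hi | hi
      · exact Or.inl hi
      · exact Or.inr ⟨_, by simpa [stale] using hi, by simp [outGates]⟩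
      · exact Or.inr ⟨_, by simpa [stale] using hi, by simp [outGates]⟩
    calc (stale ω S (t + 1)).card ≤ S.card + (stale ω S t).card * Δ :=
          (Finset.card_le_card hsub).trans ((Finset.card_union_le _ _).trans
            (Nat.add_le_add_left (Finset.card_biUnion_le_card_mul _ _ _ fun j _ => hΔ j) _))
      _ ≤ (1 + Δ) ^ t * S.card + (1 + Δ) ^ t * S.card * Δ :=
          Nat.add_le_add (Nat.le_mul_of_pos_left _ (by positivity)) (Nat.mul_le_mul_right _ ih)
      _ = _ := by ring

/-! ### Labels that ignore a set of gates -/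

theorem update_eq_off {ω : Fin n → Gate n} {S : Finset (Fin n)} {i : Fin n} (hi : i ∈ S)
    (g : Gate n) : ∀ j ∉ S, Function.update ω i g j = ω j := by
  intro j hj
  rw [Function.update_of_ne]
  rintro rfl
  exact hj hi

theorem stale_update {ω : Fin n → Gate n} {S : Finset (Fin n)} {i : Fin n} (hi : i ∈ S)
    (g : Gate n) (t : ℕ) : stale (Function.update ω i g) S t = stale ω S t := by
  ext j
  simp only [stale, Finset.mem_filter, Finset.mem_univ, true_and, not_iff_not]
  exact ⟨fun h => h.congr (update_eq_off hi g), fun h => h.congr fun k hk =>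
    (update_eq_off hi g k hk).symm⟩

theorem label_update {ω : Fin n → Gate n} {S : Finset (Fin n)} {i : Fin n} (hi : i ∈ S)
    (g : Gate n) (t : ℕ) : label (Function.update ω i g) S t = label ω S t :=
  funext fun j => label_congr (update_eq_off hi g) t j

theorem edgeProb_mono (hw : IsDistribution w) (hn : 2 ≤ n) (ω : Fin n → Gate n)
    (S : Finset (Fin n)) (t : ℕ) (j : Fin n) :
    edgeProb w (label ω ∅ t) j ≤ edgeProb w (label ω S t) j :=
  Finset.sum_le_sum fun g _ => mul_le_mul_of_nonneg_left
    (ind_mono (EffEdge.mono (label_refines ω S t))) ((isWeight_gateWeight hw hn).nonneg g)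

theorem edgeProb_nonneg (hw : IsDistribution w) (hn : 2 ≤ n) (τ : Fin n → Option Bool)
    (j : Fin n) : 0 ≤ edgeProb w τ j :=
  Finset.sum_nonneg fun g _ => mul_nonneg ((isWeight_gateWeight hw hn).nonneg g) (ind_nonneg _)

/-- A new effective edge from `j` needs a gate whose other input is stale, an event of probability
at most `8 * (stale ω S t).card / n ^ 2`. -/
theorem edgeProb_label_le (hw : IsDistribution w) (hn : 2 ≤ n) (ω : Fin n → Gate n)
    (S : Finset (Fin n)) (t : ℕ) (j : Fin n) {κ : ℝ} (hκ : 8 * (stale ω S t).card ≤ κ * n) :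
    edgeProb w (label ω S t) j ≤ edgeProb w (label ω ∅ t) j + κ / n := by
  have hn0 : (0 : ℝ) < n := by
    have : 0 < n := by omega
    exact_mod_cast this
  have h1 := sum_gateWeight_inputs_le hw hn {j} (stale ω S t)
  have h2 := sum_gateWeight_inputs_le hw hn (stale ω S t) {j}
  rw [Finset.card_singleton, Nat.cast_one, mul_one] at h1 h2
  have hnot : ∀ k, k ∉ stale ω S t → label ω S t k = label ω ∅ t k := by
    intro k hk
    simp only [stale, Finset.mem_filter, Finset.mem_univ, true_and, not_not] at hk
    exact hk.label_eq
  calc edgeProb w (label ω S t) j ≤ ∑ g, gateWeight w n g * (ind (EffEdge g (label ω ∅ t) j) +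
        (ind (g.1.1.1 ∈ ({j} : Finset (Fin n)) ∧ g.1.1.2 ∈ stale ω S t) +
          ind (g.1.1.1 ∈ stale ω S t ∧ g.1.1.2 ∈ ({j} : Finset (Fin n))))) := by
        refine Finset.sum_le_sum fun g _ => mul_le_mul_of_nonneg_left ?_
          ((isWeight_gateWeight hw hn).nonneg g)
        refine le_trans (ind_mono ?_) ((ind_or_le _ _).trans (add_le_add le_rfl (ind_or_le _ _)))
        rintro (⟨h, h'⟩ | ⟨h, h'⟩)
        · by_cases hs : g.1.1.2 ∈ stale ω S t
          · exact Or.inr (Or.inl ⟨by simp [h], hs⟩)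
          · rw [hnot _ hs] at h'
            exact Or.inl (Or.inl ⟨h, h'⟩)
        · by_cases hs : g.1.1.1 ∈ stale ω S t
          · exact Or.inr (Or.inr ⟨hs, by simp [h]⟩)
          · rw [hnot _ hs] at h'
            exact Or.inl (Or.inr ⟨h, h'⟩)
    _ ≤ edgeProb w (label ω ∅ t) j + 8 * (stale ω S t).card / (n : ℝ) ^ 2 := by
        simp only [mul_add, Finset.sum_add_distrib]
        rw [edgeProb]
        have : 8 * ((stale ω S t).card : ℝ) / (n : ℝ) ^ 2 =
            4 * (stale ω S t).card / (n : ℝ) ^ 2 + 4 * (stale ω S t).card / (n : ℝ) ^ 2 := by ring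
        linarith
    _ ≤ _ := by
        refine add_le_add le_rfl ?_
        rw [div_le_div_iff₀ (by positivity) hn0]
        nlinarith

/-! ### Effective walks -/

/-- The targets of the edges of the walk with vertices `v 0, …, v (k - 1), e`. -/
def walkTgt {k : ℕ} (v : Fin k → Fin n) (e : Fin n) (l : Fin k) : Fin n :=
  if h : (l : ℕ) + 1 < k then v ⟨l + 1, h⟩ else e

/-- The vertices `v 0, …, v (k - 1), e` form a walk of effective edges with distinct targets. -/
def IsEffWalk (ω : Fin n → Gate n) (t : ℕ) {k : ℕ} (v : Fin k → Fin n) (e : Fin n) : Prop :=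
  Function.Injective (walkTgt v e) ∧ ∀ l, EffRel ω t (v l) (walkTgt v e l)

/-- The labels make the network subcritical, and small sets of gates influence few labels. -/
def IsGood (w : BoolFn → ℝ) (ω : Fin n → Gate n) (t K : ℕ) (Λ κ : ℝ) : Prop :=
  meanEff w (label ω ∅ t) ≤ Λ ∧
    ∀ S : Finset (Fin n), S.card ≤ K → 8 * ((stale ω S t).card : ℝ) ≤ κ * n

/-- Passing to labels that ignore the target set `S` makes the target gates independent of
everything else, so they are averaged out. Returning to the full labels removes `S` from the bound,
which can then be summed over walks. -/
theorem expect_isEffWalk_le (hw : IsDistribution w) (hn : 2 ≤ n) (t : ℕ) {k K : ℕ} (hk : k ≤ K)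
    (Λ κ : ℝ) (hκ : 0 ≤ κ) (v : Fin k → Fin n) (e : Fin n) :
    expect (gateWeight w n) (fun ω => ind (IsGood w ω t K Λ κ ∧ IsEffWalk ω t v e)) ≤
      expect (gateWeight w n) (fun ω => ind (meanEff w (label ω ∅ t) ≤ Λ + κ) *
        ∏ l, (edgeProb w (label ω ∅ t) (v l) + κ / n)) := by
  classical
  have hρ := isWeight_gateWeight hw hn
  by_cases hinj : Function.Injective (walkTgt v e)
  swap
  · have : ∀ ω : Fin n → Gate n, ind (IsGood w ω t K Λ κ ∧ IsEffWalk ω t v e) = 0 := fun ω =>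
      ind_of_false fun h => hinj h.2.1
    simp only [this, expect_const hρ]
    exact expect_nonneg hρ fun ω => mul_nonneg (ind_nonneg _) (Finset.prod_nonneg fun l _ =>
      add_nonneg (edgeProb_nonneg hw hn _ _) (by positivity))
  set S : Finset (Fin n) := Finset.univ.image (walkTgt v e) with hS
  have hmem : ∀ l, walkTgt v e l ∈ S := fun l => Finset.mem_image_of_mem _ (Finset.mem_univ l)
  have hScard : S.card ≤ K := by
    refine Finset.card_image_le.trans ?_
    simpa using hk
  set Φ : (Fin n → Gate n) → ℝ := fun ω =>
    ind (8 * ((stale ω S t).card : ℝ) ≤ κ * n ∧ meanEff w (label ω S t) ≤ Λ + κ) with hΦ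
  set ψ : Fin k → Gate n → (Fin n → Gate n) → ℝ := fun l g ω =>
    ind (EffEdge g (label ω S t) (v l)) with hψ
  have hmean : ∀ ω : Fin n → Gate n, 8 * ((stale ω S t).card : ℝ) ≤ κ * n →
      meanEff w (label ω S t) ≤ meanEff w (label ω ∅ t) + κ := by
    intro ω hω
    have hn0 : (n : ℝ) ≠ 0 := by
      have : n ≠ 0 := by omega
      exact_mod_cast this
    calc _ ≤ ∑ j : Fin n, (edgeProb w (label ω ∅ t) j + κ / n) :=
          Finset.sum_le_sum fun j _ => edgeProb_label_le hw hn ω S t j hω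
      _ = _ := by
          rw [Finset.sum_add_distrib, meanEff]
          simp only [Finset.sum_const, Finset.card_univ, Fintype.card_fin, nsmul_eq_mul]
          field_simp
  calc _ ≤ expect (gateWeight w n)
        (fun ω => Φ ω * ∏ l ∈ Finset.univ, ψ l (ω (walkTgt v e l)) ω) := by
        refine expect_mono hρ fun ω => ?_
        rw [hΦ, hψ]
        dsimp only
        rw [← ind_forall, ← ind_and]
        refine ind_mono fun h => ?_
        have h8 := h.1.2 S hScard
        refine ⟨⟨h8, (hmean ω h8).trans (by linarith [h.1.1])⟩, fun l => ?_⟩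
        exact EffEdge.mono (label_refines ω S t) (h.2.2 l)
    _ = expect (gateWeight w n)
        (fun ω => Φ ω * ∏ l ∈ Finset.univ, ∑ g, gateWeight w n g * ψ l g ω) :=
        expect_mul_prod hρ (walkTgt v e) hinj ψ
          (fun l l' g g' ω => by simp only [hψ, label_update (hmem l')]) _ Φ
          (fun l g ω => by simp only [hΦ, label_update (hmem l), stale_update (hmem l)])
    _ ≤ _ := by
        refine expect_mono hρ fun ω => ?_
        by_cases h : 8 * ((stale ω S t).card : ℝ) ≤ κ * n ∧ meanEff w (label ω S t) ≤ Λ + κ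
        · have h' : meanEff w (label ω ∅ t) ≤ Λ + κ :=
            (Finset.sum_le_sum fun j _ => edgeProb_mono hw hn ω S t j).trans h.2
          rw [hΦ]
          dsimp only
          rw [ind_of_true h, ind_of_true h', one_mul, one_mul]
          exact Finset.prod_le_prod (fun l _ => edgeProb_nonneg hw hn _ _)
            fun l _ => edgeProb_label_le hw hn ω S t (v l) h.1
        · rw [hΦ]
          dsimp only
          rw [ind_of_false h, zero_mul]
          exact mul_nonneg (ind_nonneg _) (Finset.prod_nonneg fun l _ =>
            add_nonneg (edgeProb_nonneg hw hn _ _) (by positivity))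

/-- The sum over walks of the product is a `k`-th power of a sum over gates. The end `e v` may
depend on `v`, which covers both cycles and walks with a fixed end. -/
theorem sum_expect_isEffWalk_le (hw : IsDistribution w) (hn : 2 ≤ n) (t : ℕ) {k K : ℕ}
    (hk : k ≤ K) (Λ κ : ℝ) (hκ : 0 ≤ κ) (hΛ : 0 ≤ Λ) (e : (Fin k → Fin n) → Fin n) :
    ∑ v : Fin k → Fin n,
      expect (gateWeight w n) (fun ω => ind (IsGood w ω t K Λ κ ∧ IsEffWalk ω t v (e v))) ≤
        (Λ + 2 * κ) ^ k := by
  have hρ := isWeight_gateWeight hw hn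
  have hn0 : (n : ℝ) ≠ 0 := by
    have : n ≠ 0 := by omega
    exact_mod_cast this
  refine (Finset.sum_le_sum fun v _ => expect_isEffWalk_le hw hn t hk Λ κ hκ v (e v)).trans ?_
  rw [← expect_sum, ← expect_const (ι := Fin n) hρ ((Λ + 2 * κ) ^ k)]
  refine expect_mono hρ fun ω => ?_
  rw [← Finset.mul_sum, ← Fintype.sum_pow (fun j => edgeProb w (label ω ∅ t) j + κ / n)]
  have h1 : ∑ j : Fin n, (edgeProb w (label ω ∅ t) j + κ / n) = meanEff w (label ω ∅ t) + κ := by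
    rw [Finset.sum_add_distrib, meanEff]
    simp only [Finset.sum_const, Finset.card_univ, Fintype.card_fin, nsmul_eq_mul]
    field_simp
  rw [h1]
  have h0 : 0 ≤ meanEff w (label ω ∅ t) := Finset.sum_nonneg fun j _ => edgeProb_nonneg hw hn _ _
  by_cases h : meanEff w (label ω ∅ t) ≤ Λ + κ
  · rw [ind_of_true h, one_mul]
    exact pow_le_pow_left₀ (by linarith) (by linarith) k
  · rw [ind_of_false h, zero_mul]
    positivity

open Classical in
/-- Without long effective walks, the cyclic gates are counted by the short effective cycles. -/
theorem card_cyclicGates_le {ω : Fin n → Gate n} {t K : ℕ}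
    (hK : ¬ ∃ x : Fin n × (Fin K → Fin n), IsEffWalk ω t x.2 x.1) :
    ((cyclicGates ω t).card : ℝ) ≤
      ∑ m ∈ Finset.range K, ∑ v : Fin (m + 1) → Fin n, ind (IsEffWalk ω t v (v 0)) := by
  have hsub : cyclicGates ω t ⊆ (Finset.range K).biUnion fun m =>
      (Finset.univ.filter fun v : Fin (m + 1) → Fin n => IsEffWalk ω t v (v 0)).image
        fun v => v 0 := by
    intro i hi
    simp only [cyclicGates, Finset.mem_filter, Finset.mem_univ, true_and] at hi
    obtain ⟨k, hk, u, hu0, huk, hu, hne⟩ := exists_simple_closed_walk hi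
    have hinj : ∀ a b, 1 ≤ a → a ≤ k → 1 ≤ b → b ≤ k → u a = u b → a = b := by
      intro a b ha hak hb hbk hab
      rcases lt_trichotomy a b with h | h | h
      · exact absurd hab (hne a b ha h hbk)
      · exact h
      · exact absurd hab.symm (hne b a hb h hak)
    have hwalk : ∀ k', k' ≤ k → IsEffWalk ω t (fun l : Fin k' => u l) (u k') := by
      intro k' hk'
      have htgt : ∀ l : Fin k', walkTgt (fun l : Fin k' => u l) (u k') l = u (l + 1) := by
        intro l
        unfold walkTgt
        split_ifs with h
        · rfl
        · rw [show (l : ℕ) + 1 = k' by omega]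
      constructor
      · intro a b hab
        rw [htgt, htgt] at hab
        have := hinj _ _ (by omega) (by omega) (by omega) (by omega) hab
        exact Fin.ext (by omega)
      · intro l
        rw [htgt]
        exact hu l (by omega)
    -- A cycle longer than `K` would contain a walk of `K` edges with distinct targets.
    by_cases hkK : k ≤ K
    · rw [Finset.mem_biUnion]
      refine ⟨k - 1, Finset.mem_range.2 (by omega), Finset.mem_image.2 ?_⟩
      refine ⟨fun l => u l, Finset.mem_filter.2 ⟨Finset.mem_univ _, ?_⟩, hu0⟩
      have := hwalk (k - 1 + 1) (by omega)
      rwa [Nat.sub_add_cancel hk, huk, ← hu0, ← Nat.sub_add_cancel hk] at this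
    · exact absurd ⟨(u K, fun l : Fin K => u l), hwalk K (by omega)⟩ hK
  have h1 : (cyclicGates ω t).card ≤ ∑ m ∈ Finset.range K,
      (Finset.univ.filter fun v : Fin (m + 1) → Fin n => IsEffWalk ω t v (v 0)).card :=
    (Finset.card_le_card hsub).trans (Finset.card_biUnion_le.trans
      (Finset.sum_le_sum fun m _ => Finset.card_image_le))
  refine (Nat.cast_le.2 h1).trans (le_of_eq ?_)
  push_cast
  refine Finset.sum_congr rfl fun m _ => ?_
  rw [Finset.card_filter]
  push_cast
  exact Finset.sum_congr rfl fun v _ => by unfold ind; rfl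

/-- The four terms are the ways to fail: a large mean, a large outdegree, a long effective walk,
many short effective cycles. The same `K` bounds outdegrees and walk lengths. -/
theorem expect_cyclicGates_large_le (hw : IsDistribution w) (hn : 2 ≤ n) (t K M : ℕ) {Λ κ : ℝ}
    (hκ : 0 ≤ κ) (hΛ : 0 ≤ Λ) (hlt : Λ + 2 * κ < 1)
    (hsmall : 8 * ((1 + K : ℝ) ^ t * K) ≤ κ * n) :
    expect (gateWeight w n) (fun ω => ind (M + 1 ≤ (cyclicGates ω t).card)) ≤
      expect (gateWeight w n) (fun ω => ind (Λ ≤ meanEff w (label ω ∅ t))) +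
        n * (Real.exp 8 / 2 ^ K) + n * (Λ + 2 * κ) ^ K +
          1 / (1 - (Λ + 2 * κ)) / (M + 1) := by
  have hρ := isWeight_gateWeight hw hn
  set lam := Λ + 2 * κ with hlam
  have hlam0 : 0 ≤ lam := by positivity
  set good : (Fin n → Gate n) → Prop := fun ω => IsGood w ω t K Λ κ
  have hsplit : ∀ ω : Fin n → Gate n, ind (M + 1 ≤ (cyclicGates ω t).card) ≤
      ind (Λ ≤ meanEff w (label ω ∅ t)) + ind (∃ j, K ≤ (outGates ω j).card) +
        ∑ e : Fin n, ∑ v : Fin K → Fin n, ind (good ω ∧ IsEffWalk ω t v e) +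
          ind ((M + 1 : ℝ) ≤ ∑ m ∈ Finset.range K, ∑ v : Fin (m + 1) → Fin n,
            ind (good ω ∧ IsEffWalk ω t v (v 0))) := by
    intro ω
    have h3 : ind (∃ x : Fin n × (Fin K → Fin n), good ω ∧ IsEffWalk ω t x.2 x.1) ≤
        ∑ e : Fin n, ∑ v : Fin K → Fin n, ind (good ω ∧ IsEffWalk ω t v e) :=
      (ind_exists_le _).trans (le_of_eq (Fintype.sum_prod_type _))
    refine le_trans ?_ (add_le_add_left (add_le_add le_rfl h3) _)
    refine le_trans (ind_mono ?_) ((ind_or_le _ _).trans (add_le_add_left ((ind_or_le _ _).trans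
      (add_le_add_left (ind_or_le _ _) _)) _))
    intro hM
    by_contra hcon
    simp only [not_or] at hcon
    obtain ⟨⟨⟨h1, h2⟩, h3⟩, h4⟩ := hcon
    push Not at h2
    have hg : good ω := by
      refine ⟨(not_le.1 h1).le, fun S hS => le_trans ?_ hsmall⟩
      have h5 := card_stale_le (fun j => (h2 j).le) S t
      have h6 : (stale ω S t).card ≤ (1 + K) ^ t * K := h5.trans (Nat.mul_le_mul_left _ hS)
      have h7 : ((stale ω S t).card : ℝ) ≤ (1 + K) ^ t * K := by exact_mod_cast h6
      linarith
    have h5 := card_cyclicGates_le (K := K) fun ⟨x, hx⟩ => h3 ⟨x, hg, hx⟩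
    refine h4 (le_trans ?_ (h5.trans (le_of_eq ?_)))
    · exact_mod_cast hM
    · refine Finset.sum_congr rfl fun m _ => Finset.sum_congr rfl fun v _ => ?_
      exact ind_congr ⟨fun h => ⟨hg, h⟩, fun h => h.2⟩
  have hpath : expect (gateWeight w n) (fun ω =>
      ∑ e : Fin n, ∑ v : Fin K → Fin n, ind (good ω ∧ IsEffWalk ω t v e)) ≤ n * lam ^ K := by
    rw [expect_sum]
    calc _ ≤ ∑ _e : Fin n, lam ^ K := Finset.sum_le_sum fun e _ => by
          rw [expect_sum]
          exact sum_expect_isEffWalk_le hw hn t le_rfl Λ κ hκ hΛ fun _ => e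
      _ = _ := by simp
  have hcycle : expect (gateWeight w n) (fun ω => ∑ m ∈ Finset.range K,
      ∑ v : Fin (m + 1) → Fin n, ind (good ω ∧ IsEffWalk ω t v (v 0))) ≤ 1 / (1 - lam) := by
    rw [expect_sum]
    calc _ ≤ ∑ m ∈ Finset.range K, lam ^ m := Finset.sum_le_sum fun m hm => by
          rw [expect_sum]
          refine (sum_expect_isEffWalk_le hw hn t (Finset.mem_range.1 hm) Λ κ hκ hΛ
            fun v => v 0).trans ?_
          exact pow_le_pow_of_le_one hlam0 hlt.le (Nat.le_succ m)
      _ ≤ _ := by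
          rw [one_div, ← tsum_geometric_of_lt_one hlam0 hlt]
          exact (summable_geometric_of_lt_one hlam0 hlt).sum_le_tsum _
            fun m _ => pow_nonneg hlam0 m
  have hM : (0 : ℝ) < M + 1 := by positivity
  have hmarkov : expect (gateWeight w n) (fun ω => ind ((M + 1 : ℝ) ≤ ∑ m ∈ Finset.range K,
      ∑ v : Fin (m + 1) → Fin n, ind (good ω ∧ IsEffWalk ω t v (v 0)))) ≤
        1 / (1 - lam) / (M + 1) :=
    (expect_ind_le_div hρ (fun ω => Finset.sum_nonneg fun m _ => Finset.sum_nonneg fun v _ =>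
      ind_nonneg _) hM).trans (div_le_div_of_nonneg_right hcycle hM.le)
  refine (expect_mono hρ hsplit).trans ?_
  rw [expect_add, expect_add, expect_add]
  have := expect_outGates_large_le hw hn K
  linarith

end Walks

/-! ### Bounded state cycles -/

/-- There are lengths `K` that are polynomially small but exponentially large compared to `n`. -/
theorem eventually_exists_length (t : ℕ) {κ r η : ℝ} (hκ : 0 < κ) (hr0 : 0 < r) (hr1 : r < 1)
    (hη : 0 < η) : ∀ᶠ n : ℕ in Filter.atTop,
      ∃ K : ℕ, 8 * ((1 + K : ℝ) ^ t * K) ≤ κ * n ∧ n * r ^ K < η := by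
  classical
  set good : ℕ → ℕ → Prop := fun n K => 8 * ((1 + K : ℝ) ^ t * K) ≤ κ * n with hgood
  -- The largest admissible `K` tends to infinity, and its maximality bounds `n` by a polynomial in
  -- `K`, which `r ^ K` beats.
  set len : ℕ → ℕ := fun n => Nat.findGreatest (good n) n with hlen
  have hspec : ∀ n, good n (len n) := fun n =>
    Nat.findGreatest_spec (m := 0) (Nat.zero_le n) (by simp only [hgood]; simp; positivity)
  have htend : Filter.Tendsto len Filter.atTop Filter.atTop := by
    refine Filter.tendsto_atTop.2 fun b => ?_
    obtain ⟨N, hN⟩ := exists_nat_ge (8 * ((1 + b : ℝ) ^ t * b) / κ)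
    filter_upwards [Filter.eventually_ge_atTop (max b N)] with n hn
    refine Nat.le_findGreatest (le_of_max_le_left hn) ?_
    have h1 : (N : ℝ) ≤ n := by exact_mod_cast le_of_max_le_right hn
    have h2 := (div_le_iff₀ hκ).1 (hN.trans h1)
    simp only [hgood]
    linarith
  have hle : ∀ n : ℕ, (n : ℝ) ≤ (8 / κ + 1) * (len n + 2 : ℝ) ^ (t + 1) := by
    intro n
    have hpow : ((len n : ℝ) + 2) ≤ ((len n : ℝ) + 2) ^ (t + 1) :=
      le_self_pow₀ (by linarith [(Nat.cast_nonneg (len n) : (0 : ℝ) ≤ len n)]) (by omega)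
    have h0 : (0 : ℝ) ≤ len n := Nat.cast_nonneg _
    rcases (Nat.findGreatest_le n : len n ≤ n).eq_or_lt with h | h
    · have h1 : (n : ℝ) = len n := congrArg (Nat.cast) h.symm
      have h2 : 0 ≤ 8 / κ * ((len n : ℝ) + 2) ^ (t + 1) := by positivity
      linarith
    · have h1 : ¬ good n (len n + 1) :=
        Nat.findGreatest_is_greatest (Nat.lt_succ_self _) h
      simp only [hgood, not_le] at h1
      push_cast at h1
      have h2 : (1 + ((len n : ℝ) + 1)) ^ t * ((len n : ℝ) + 1) ≤ ((len n : ℝ) + 2) ^ (t + 1) := by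
        rw [pow_succ, show 1 + ((len n : ℝ) + 1) = len n + 2 by ring]
        exact mul_le_mul_of_nonneg_left (by linarith) (by positivity)
      have h3 : (n : ℝ) ≤ 8 / κ * ((len n : ℝ) + 2) ^ (t + 1) := by
        rw [div_mul_eq_mul_div, le_div_iff₀ hκ]
        linarith
      have h4 : 0 ≤ ((len n : ℝ) + 2) ^ (t + 1) := by positivity
      linarith
  have hlim : Filter.Tendsto (fun m : ℕ => (8 / κ + 1) / r ^ 2 * ((m : ℝ) ^ (t + 1) * r ^ m))
      Filter.atTop (nhds 0) := by
    have := (tendsto_pow_const_mul_const_pow_of_abs_lt_one (t + 1)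
      (by rwa [abs_of_pos hr0] : |r| < 1)).const_mul ((8 / κ + 1) / r ^ 2)
    simpa using this
  have hlim' := hlim.comp ((Filter.tendsto_add_atTop_nat 2).comp htend)
  filter_upwards [hlim'.eventually (gt_mem_nhds hη)] with n hn
  refine ⟨len n, hspec n, lt_of_le_of_lt ?_ hn⟩
  simp only [Function.comp]
  push_cast
  calc (n : ℝ) * r ^ len n ≤ (8 / κ + 1) * (len n + 2 : ℝ) ^ (t + 1) * r ^ len n :=
        mul_le_mul_of_nonneg_right (hle n) (by positivity)
    _ = _ := by
        rw [pow_add r]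
        field_simp

end

end RandomBCA

open RandomBCA in
theorem theorem4p10 (w : RandomBCA.BoolFn → ℝ)
    (hw : RandomBCA.IsDistribution w) (hsymm : RandomBCA.IsSymmetric w)
    (hac : RandomBCA.probC w < RandomBCA.probA w) :
    ∀ ε : ℝ, 0 < ε → ∃ s : ℕ, ∀ n : ℕ, 2 ≤ n →
      RandomBCA.pr w n (fun B => B.HasStateCycleLargerThan s) < ε := by
  intro ε hε
  set γ := probA w - probC w with hγ
  have hγ0 : 0 < γ := sub_pos.2 hac
  have hγ1 : γ ≤ 1 := by linarith [probA_le_one hw, probC_nonneg hw]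
  -- The mean threshold is at most `1 - γ + 2 * (γ / 8) + γ / 4 = 1 - γ / 2`; with `κ = γ / 8` the
  -- walk ratio is `1 - γ / 4`.
  obtain ⟨t, ht⟩ := exists_unforced_le hw hsymm hac (show 0 < γ / 8 by positivity)
  obtain ⟨C, hC⟩ := expect_meanEff_large_le hw hsymm t (show 0 < γ / 4 by positivity)
  have hlam : 1 - γ / 2 + 2 * (γ / 8) = 1 - γ / 4 := by ring
  have hexp : 1 ≤ Real.exp 8 := Real.one_le_exp (by norm_num)
  have hη : 0 < ε / 4 / Real.exp 8 := by positivity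
  obtain ⟨M, hM⟩ : ∃ M : ℕ, 1 / (1 - (1 - γ / 4)) / ((M : ℝ) + 1) < ε / 4 := by
    obtain ⟨M, hM⟩ := exists_nat_gt (1 / (1 - (1 - γ / 4)) / (ε / 4))
    refine ⟨M, ?_⟩
    rw [div_lt_iff₀ (by positivity)] at hM ⊢
    nlinarith
  have hlarge : ∀ᶠ n : ℕ in Filter.atTop, C / (n : ℝ) < ε / 4 :=
    (tendsto_const_div_atTop_nhds_zero_nat C).eventually (gt_mem_nhds (by positivity))
  obtain ⟨N, hN⟩ := Filter.eventually_atTop.1 (hlarge.and (eventually_exists_length t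
    (show 0 < γ / 8 by positivity) (show 0 < 1 - γ / 4 by linarith)
    (show 1 - γ / 4 < 1 by linarith) hη))
  -- For `n < N` the trivial bound `2 ^ n` on the number of states suffices; for `n ≥ N` each of the
  -- four failure terms is below `ε / 4`.
  refine ⟨2 ^ max M N, fun n hn => ?_⟩
  have hρ := isWeight_gateWeight hw hn
  rw [pr_eq_expect]
  rcases lt_or_ge n N with hnN | hnN
  · have h0 : ∀ ω : Fin n → Gate n,
        ind ((toAut ω).HasStateCycleLargerThan (2 ^ max M N)) = 0 := by
      refine fun ω => ind_of_false ?_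
      rintro ⟨x, hx⟩
      have h1 := ncard_stateCycle_le_two_pow (toAut ω) x
      have h2 : 2 ^ n ≤ 2 ^ max M N :=
        Nat.pow_le_pow_right (by omega) (hnN.le.trans (le_max_right _ _))
      omega
    simp only [h0, expect_const hρ]
    exact hε
  · obtain ⟨hCn, K, hK, hKr⟩ := hN n hnN
    have h1 : expect (gateWeight w n)
        (fun ω => ind ((toAut ω).HasStateCycleLargerThan (2 ^ max M N))) ≤
          expect (gateWeight w n) (fun ω => ind (M + 1 ≤ (cyclicGates ω t).card)) := by
      refine expect_mono hρ fun ω => ind_mono ?_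
      rintro ⟨x, hx⟩
      have h1 := ncard_stateCycle_le_cyclicGates ω t x
      have h2 := (Nat.pow_lt_pow_iff_right (by norm_num : 1 < 2)).1 (hx.trans_le h1)
      have h3 := le_max_left M N
      omega
    have h2 := expect_cyclicGates_large_le hw hn t K M (Λ := 1 - γ / 2) (κ := γ / 8)
      (by positivity) (by linarith) (by linarith) hK
    rw [hlam] at h2
    have h3 : expect (gateWeight w n) (fun ω => ind (1 - γ / 2 ≤ meanEff w (label ω ∅ t))) ≤
        C / n := by
      refine le_trans (expect_mono hρ fun ω => ind_mono fun h => ?_) (hC n hn)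
      linarith
    have h4 : (n : ℝ) * (1 - γ / 4) ^ K * Real.exp 8 < ε / 4 := (lt_div_iff₀ (by positivity)).1 hKr
    have hpow0 : 0 ≤ (n : ℝ) * (1 - γ / 4) ^ K :=
      mul_nonneg (Nat.cast_nonneg _) (pow_nonneg (by linarith) _)
    have h5 : (n : ℝ) * (1 - γ / 4) ^ K ≤ n * (1 - γ / 4) ^ K * Real.exp 8 :=
      le_mul_of_one_le_right hpow0 hexp
    have h6 : (n : ℝ) * (Real.exp 8 / 2 ^ K) ≤ n * (1 - γ / 4) ^ K * Real.exp 8 := by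
      -- As `γ ≤ 1`, the ratio is at least `3 / 4`, so the outdegree term is also controlled by the
      -- choice of `K`.
      have : (1 : ℝ) / 2 ^ K ≤ (1 - γ / 4) ^ K := by
        rw [← one_div_pow]
        exact pow_le_pow_left₀ (by norm_num) (by linarith) K
      calc (n : ℝ) * (Real.exp 8 / 2 ^ K) = n * (1 / 2 ^ K) * Real.exp 8 := by ring
        _ ≤ _ := by gcongr
    linarith
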